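/- Let $W=(W(t))_{t\ge 0}$ be a standard Brownian motion with $W(0)=0$, let $b\neq 0$ be real and $c\ge 0$. For $\varepsilon>0$ let $$V_\varepsilon(c,b)=\frac1\varepsilon\int_c^\infty \mathbf 1\{bt-\tfrac12\varepsilon\le W(t)\le bt+\tfrac12\varepsilon\}\,dt$$ be the relative time that $W$ spends along the ray $w=bt$ during $t\ge c$. Write $\Phi$ for the standard normal distribution function, $k(u)=2(1-\Phi(u))$, $\mathrm{Exp}(\lambda)$ for the exponential distribution with rate $\lambda$ (mean $1/\lambda$), and $\delta_0$ for the unit point mass at $0$. Then $V_\varepsilon(c,b)$ is almost surely finite for every $\varepsilon>0$, and, as $\varepsilon\to 0^+$, it converges in distribution to the mixture $$k(|b|\sqrt c)\,\mathrm{Exp}(|b|)+\bigl(1-k(|b|\sqrt c)\bigr)\,\delta_0 .$$ Moreover, if $b>0$ and $c>0$, then $$\Pr\Bigl\{\max_{0\le t\le 1/c}W(t)\le b\Bigr\}=2\Phi(b\sqrt c)-1=\Pr\{|W(1/c)|\le b\}.$$ -/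

import Mathlib

open MeasureTheory ProbabilityTheory Filter Topology
open scoped NNReal ENNReal

/-- The relative time spent along the ray `w = b t` during `t ≥ c` by the path `W · ω`:
`(1/ε) ∫_c^∞ 1{b t - ε/2 ≤ W(t) ≤ b t + ε/2} dt`, as an element of `[0, ∞]`.
On the domain of integration `t ≥ c ≥ 0`, so `t.toNNReal` is just `t`. -/
noncomputable def relativeTime {Ω : Type*} (W : ℝ≥0 → Ω → ℝ) (c : ℝ≥0) (b ε : ℝ) (ω : Ω) :
    ℝ≥0∞ :=
  ENNReal.ofReal (1 / ε) *
    ∫⁻ t in Set.Ici (c : ℝ),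
      Set.indicator
        {t : ℝ | b * t - ε / 2 ≤ W t.toNNReal ω ∧ W t.toNNReal ω ≤ b * t + ε / 2} 1 t

/-- The standard normal distribution function `Φ`. -/
noncomputable def stdNormalCDF (u : ℝ) : ℝ := cdf (gaussianReal 0 1) u

/-- `k(u) = 2 (1 - Φ(u))`. -/
noncomputable def tailWeight (u : ℝ) : ℝ := 2 * (1 - stdNormalCDF u)

/-- The mixture `k(|b|√c) Exp(|b|) + (1 - k(|b|√c)) δ₀`. For `u ≥ 0` one has `0 ≤ k(u) ≤ 1`. -/
noncomputable def limitLaw (c : ℝ≥0) (b : ℝ) : Measure ℝ :=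
  ENNReal.ofReal (tailWeight (|b| * √(c : ℝ))) • expMeasure |b| +
    ENNReal.ofReal (1 - tailWeight (|b| * √(c : ℝ))) • Measure.dirac 0

/-! Replacing `W` by `-W` if necessary, let the slope be positive, `b > 0`. The convergence is
proved by the method of moments. For `F t = ∫_t^∞ f`, with `f` the normalised strip density along
the path of `W(t) - b t`, one has `F c ^ (n+1) = (n+1) ∫_c^∞ f(t) F(t)^n dt`. By the Markov property
`F(t)^n` may be replaced by the `n`-th moment of a fresh occupation time started inside the strip.
Iterating, the moment of order `n+1` is `(n+1)!` times one Green kernel over times after `c` and `n`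
over times after `0`, all evaluated within distance `ε` of the origin. Completing the square
squeezes these between bounds with the same limit (`IsStrictBrownian.lintegral_occupation_pow_mem`),
and the antiderivative `(2/b) Φ(b√t)` evaluates the kernel at the origin: `k(b√c)/b` after `c`, and
`1/b` after `0` (`greenKernel_zero`). The limiting moments `k(b√c) (n+1)!/b^(n+1)` are those of the
mixture.

Moments bounded by `A n! C^n` uniformly in `ε` determine the limit: characteristic functions
converge near `0` by Taylor expansion, then everywhere by steps of fixed length
(`tendsto_probabilityMeasure_of_moments`).

The law of the maximum is the reflection principle, obtained from first crossings on a grid and the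
symmetry of the increment after the crossing; path continuity makes the overshoot vanish as the mesh
shrinks. -/

/-! ### Method of moments under factorial moment bounds -/

/-- Taylor bound for the exponential on the imaginary axis. -/
lemma norm_exp_sub_sum_le_of_re_eq_zero {z : ℂ} (hz : z.re = 0) (n : ℕ) :
    ‖Complex.exp z - ∑ j ∈ Finset.range n, z ^ j / (j.factorial : ℂ)‖
      ≤ ‖z‖ ^ n / n.factorial := by
  -- Along the ray `u * z` the derivative of the remainder of order `n + 1` is `z` times the
  -- remainder of order `n`, so induction integrates the bound.
  suffices H : ∀ n : ℕ, ∀ u : ℝ, 0 ≤ u →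
      ‖Complex.exp (u * z) - ∑ j ∈ Finset.range n, (u * z) ^ j / (j.factorial : ℂ)‖
        ≤ (u * ‖z‖) ^ n / n.factorial by
    simpa using H n 1 zero_le_one
  intro n
  induction n with
  | zero =>
    intro u _
    simp [Complex.norm_exp, hz]
  | succ n ih =>
    intro u hu
    have hd : ∀ x : ℝ, HasDerivAt (fun u : ℝ ↦ Complex.exp (u * z) -
        ∑ j ∈ Finset.range (n + 1), (u * z) ^ j / (j.factorial : ℂ))
        (z * (Complex.exp (x * z) - ∑ j ∈ Finset.range n, (x * z) ^ j / (j.factorial : ℂ))) x := by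
      intro x
      have h1 : HasDerivAt (fun u : ℝ ↦ (u : ℂ) * z) z x := by
        simpa using (Complex.ofRealCLM.hasDerivAt (x := x)).mul_const z
      have h2 : HasDerivAt (fun u : ℝ ↦ Complex.exp (u * z)) (Complex.exp (x * z) * z) x :=
        h1.cexp
      have h3 : HasDerivAt
          (fun u : ℝ ↦ ∑ j ∈ Finset.range (n + 1), (u * z) ^ j / (j.factorial : ℂ))
          (∑ j ∈ Finset.range (n + 1),
            ((j : ℂ) * (x * z) ^ (j - 1) * z) / (j.factorial : ℂ)) x :=
        HasDerivAt.fun_sum fun j _ ↦ (h1.pow j).div_const _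
      refine (h2.sub h3).congr_deriv (Eq.symm ?_)
      rw [Finset.sum_range_succ', mul_sub, Finset.mul_sum]
      simp only [Nat.cast_zero, zero_mul, zero_div, add_zero]
      congr 1
      · ring
      · refine Finset.sum_congr rfl fun j _ ↦ ?_
        rw [Nat.factorial_succ]
        have : (j.factorial : ℂ) ≠ 0 := by exact_mod_cast j.factorial_ne_zero
        have h' : (j : ℂ) + 1 ≠ 0 := by exact_mod_cast j.succ_ne_zero
        push_cast
        field_simp
    have hB : ∀ x : ℝ, HasDerivAt (fun u : ℝ ↦ (u * ‖z‖) ^ (n + 1) / ((n + 1).factorial : ℝ))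
        (‖z‖ * ((x * ‖z‖) ^ n / n.factorial)) x := by
      intro x
      have h1 : HasDerivAt (fun u : ℝ ↦ u * ‖z‖) ‖z‖ x := by
        simpa using (hasDerivAt_id x).mul_const ‖z‖
      refine ((h1.pow (n + 1)).div_const ((n + 1).factorial : ℝ)).congr_deriv (Eq.symm ?_)
      rw [Nat.factorial_succ]
      have : (n.factorial : ℝ) ≠ 0 := by exact_mod_cast n.factorial_ne_zero
      push_cast
      field_simp
    refine image_norm_le_of_norm_deriv_right_le_deriv_boundary (a := 0) (b := u)
      (f' := fun x ↦ z * (Complex.exp (x * z) -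
        ∑ j ∈ Finset.range n, (x * z) ^ j / (j.factorial : ℂ)))
      (fun x _ ↦ (hd x).continuousAt.continuousWithinAt)
      (fun x _ ↦ (hd x).hasDerivWithinAt) ?_ hB ?_ ⟨hu, le_rfl⟩
    · simp [Finset.sum_range_succ']
    · intro x hx
      rw [norm_mul]
      exact mul_le_mul_of_nonneg_left (ih x hx.1) (norm_nonneg _)

lemma tendsto_of_uniform_approx {ι : Type*} {l : Filter ι} {F : ι → ℂ} {F' : ℂ}
    {a : ℕ → ι → ℂ} {a' : ℕ → ℂ} {r : ℕ → ℝ} (hr : Tendsto r atTop (𝓝 0))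
    (ha : ∀ J, Tendsto (a J) l (𝓝 (a' J))) (hF : ∀ J, ∀ᶠ i in l, ‖F i - a J i‖ ≤ r J)
    (hF' : ∀ J, ‖F' - a' J‖ ≤ r J) : Tendsto F l (𝓝 F') := by
  rw [Metric.tendsto_nhds]
  intro ε hε
  obtain ⟨J, hJ⟩ := (hr.eventually (gt_mem_nhds (by positivity : 0 < ε / 3))).exists
  filter_upwards [hF J, (Metric.tendsto_nhds.1 (ha J)) (ε / 3) (by positivity)] with i h1 h2
  rw [dist_eq_norm] at h2 ⊢
  calc ‖F i - F'‖ = ‖(F i - a J i) + (a J i - a' J) - (F' - a' J)‖ := by congr 1; ring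
    _ ≤ ‖F i - a J i‖ + ‖a J i - a' J‖ + ‖F' - a' J‖ :=
      (norm_sub_le _ _).trans (by gcongr; exact norm_add_le _ _)
    _ < ε := by linarith [hF' J]

/-- `(k + J)! / J! * 2⁻ᴶ → 0`. -/
lemma tendsto_factorial_ratio (k : ℕ) :
    Tendsto (fun J : ℕ ↦ ((k + J).factorial : ℝ) / J.factorial * (1 / 2) ^ J) atTop (𝓝 0) := by
  have h1 := (tendsto_pow_const_mul_const_pow_of_abs_lt_one k
    (r := 1 / 2) (by rw [abs_of_pos] <;> norm_num)).comp (tendsto_add_atTop_nat k)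
  have h2 := h1.const_mul ((2 : ℝ) ^ k)
  rw [mul_zero] at h2
  refine squeeze_zero (fun J ↦ by positivity) (fun J ↦ ?_) h2
  have h3 : ((k + J).factorial : ℝ) ≤ J.factorial * ((J + k : ℕ) : ℝ) ^ k := by
    rw [add_comm k J, ← Nat.factorial_mul_ascFactorial]
    exact_mod_cast Nat.mul_le_mul_left _ (Nat.ascFactorial_le_pow_add J k)
  have h4 : (0 : ℝ) < J.factorial := by exact_mod_cast J.factorial_pos
  simp only [Function.comp]
  calc ((k + J).factorial : ℝ) / J.factorial * (1 / 2) ^ J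
      ≤ ((J + k : ℕ) : ℝ) ^ k * (1 / 2) ^ J := by
        gcongr
        rw [div_le_iff₀ h4]; linarith
    _ = _ := by
        rw [pow_add]
        have : (2 : ℝ) ^ k * (1 / 2) ^ k = 1 := by rw [← mul_pow]; norm_num
        linear_combination (-((J + k : ℕ) : ℝ) ^ k * (1 / 2) ^ J) * this

/-- The measure has absolute moments of all orders, with `∫ |x|ⁿ ≤ A n! Cⁿ`. -/
structure HasMomentBound (μ : Measure ℝ) (A C : ℝ) : Prop where
  integrable : ∀ n : ℕ, Integrable (fun x ↦ |x| ^ n) μ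
  le : ∀ n : ℕ, ∫ x, |x| ^ n ∂μ ≤ A * n.factorial * C ^ n

lemma HasMomentBound.integrable_pow_mul_exp {μ : Measure ℝ} {A C : ℝ}
    (h : HasMomentBound μ A C) (k : ℕ) (t : ℝ) :
    Integrable (fun x : ℝ ↦ (x : ℂ) ^ k * Complex.exp (t * x * Complex.I)) μ := by
  refine (h.integrable k).mono' (by fun_prop) (ae_of_all _ fun x ↦ ?_)
  rw [norm_mul, norm_pow, Complex.norm_real, Real.norm_eq_abs, ← Complex.ofReal_mul,
    Complex.norm_exp_ofReal_mul_I, mul_one]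

/-- The Taylor remainder integrates to at most `|s|^J / J! * A (k+J)! C^(k+J)`, and `|s| C ≤ 1/2`
leaves a factor `2⁻ᴶ`. The admissible step `s` does not depend on the base point `t`. -/
lemma HasMomentBound.norm_taylor_le {μ : Measure ℝ} {A C : ℝ}
    (h : HasMomentBound μ A C) (hC : 0 < C) {s : ℝ} (hs : |s| ≤ 1 / (2 * C)) (t : ℝ) (k J : ℕ) :
    ‖(∫ x : ℝ, (x : ℂ) ^ k * Complex.exp ((t + s : ℝ) * x * Complex.I) ∂μ) -
      ∑ j ∈ Finset.range J, (s * Complex.I) ^ j / (j.factorial : ℂ) *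
        ∫ x : ℝ, (x : ℂ) ^ (k + j) * Complex.exp (t * x * Complex.I) ∂μ‖
      ≤ A * C ^ k * (((k + J).factorial : ℝ) / J.factorial * (1 / 2) ^ J) := by
  have e1 : ∑ j ∈ Finset.range J, (s * Complex.I) ^ j / (j.factorial : ℂ) *
        ∫ x : ℝ, (x : ℂ) ^ (k + j) * Complex.exp (t * x * Complex.I) ∂μ
      = ∫ x : ℝ, ∑ j ∈ Finset.range J, (s * Complex.I) ^ j / (j.factorial : ℂ) *
        ((x : ℂ) ^ (k + j) * Complex.exp (t * x * Complex.I)) ∂μ := by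
    rw [integral_finsetSum]
    · simp_rw [integral_const_mul]
    · exact fun j _ ↦ (h.integrable_pow_mul_exp _ _).const_mul _
  rw [e1, ← integral_sub (h.integrable_pow_mul_exp _ _)
    (integrable_finsetSum _ fun j _ ↦ (h.integrable_pow_mul_exp _ _).const_mul _)]
  have hA : 0 ≤ A := by
    have := (integral_nonneg (fun x ↦ by positivity)).trans (h.le 0)
    simpa using this
  calc _ ≤ ∫ x, |s| ^ J / J.factorial * |x| ^ (k + J) ∂μ := by
        refine norm_integral_le_of_norm_le ((h.integrable _).const_mul _) (ae_of_all _ fun x ↦ ?_)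
        have e2 : (x : ℂ) ^ k * Complex.exp ((t + s : ℝ) * x * Complex.I) -
            ∑ j ∈ Finset.range J, (s * Complex.I) ^ j / (j.factorial : ℂ) *
              ((x : ℂ) ^ (k + j) * Complex.exp (t * x * Complex.I))
            = (x : ℂ) ^ k * Complex.exp (t * x * Complex.I) * (Complex.exp (s * x * Complex.I) -
              ∑ j ∈ Finset.range J, (s * x * Complex.I) ^ j / (j.factorial : ℂ)) := by
          rw [mul_sub, Finset.mul_sum]
          congr 1
          · rw [mul_assoc ((x : ℂ) ^ k), ← Complex.exp_add]
            push_cast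
            ring_nf
          · refine Finset.sum_congr rfl fun j _ ↦ ?_
            ring
        rw [e2, norm_mul, norm_mul, norm_pow, Complex.norm_real, Real.norm_eq_abs,
          ← Complex.ofReal_mul, Complex.norm_exp_ofReal_mul_I, mul_one]
        have e3 := norm_exp_sub_sum_le_of_re_eq_zero (z := s * x * Complex.I) (by simp) J
        have e4 : ‖(s * x * Complex.I : ℂ)‖ = |s| * |x| := by simp
        rw [e4] at e3
        calc _ ≤ |x| ^ k * ((|s| * |x|) ^ J / J.factorial) := by gcongr
          _ = _ := by ring
    _ = |s| ^ J / J.factorial * ∫ x, |x| ^ (k + J) ∂μ := integral_const_mul _ _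
    _ ≤ (1 / (2 * C)) ^ J / J.factorial * (A * (k + J).factorial * C ^ (k + J)) := by
        gcongr
        exact h.le _
    _ = _ := by
        rw [div_pow, mul_pow, div_pow, pow_add]
        field_simp

/-- Convergence of moments, with a uniform exponential-type bound, gives convergence of
`∫ xᵏ exp (i t x)` for every `t`. -/
lemma tendsto_integral_pow_mul_exp_of_moments {ι : Type*} {l : Filter ι} {μ : ι → Measure ℝ}
    {ν : Measure ℝ} {A C : ℝ} (hC : 0 < C) (hμ : ∀ᶠ i in l, HasMomentBound (μ i) A C)
    (hν : HasMomentBound ν A C)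
    (hlim : ∀ n : ℕ, Tendsto (fun i ↦ ∫ x, x ^ n ∂μ i) l (𝓝 (∫ x, x ^ n ∂ν))) (t : ℝ) (k : ℕ) :
    Tendsto (fun i ↦ ∫ x : ℝ, (x : ℂ) ^ k * Complex.exp (t * x * Complex.I) ∂μ i) l
      (𝓝 (∫ x : ℝ, (x : ℂ) ^ k * Complex.exp (t * x * Complex.I) ∂ν)) := by
  -- All powers `k` are carried together, since expanding at the base point involves the powers `k +
  -- j` there.
  have key : ∀ N : ℕ, ∀ t : ℝ, |t| ≤ N * (1 / (2 * C)) → ∀ k : ℕ,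
      Tendsto (fun i ↦ ∫ x : ℝ, (x : ℂ) ^ k * Complex.exp (t * x * Complex.I) ∂μ i) l
      (𝓝 (∫ x : ℝ, (x : ℂ) ^ k * Complex.exp (t * x * Complex.I) ∂ν)) := by
    intro N
    induction N with
    | zero =>
      intro t ht k
      have ht0 : t = 0 := by simpa using ht
      subst ht0
      simp only [Complex.ofReal_zero, zero_mul, Complex.exp_zero, mul_one]
      have e : ∀ m : Measure ℝ, ∫ x : ℝ, (x : ℂ) ^ k ∂m = ((∫ x : ℝ, x ^ k ∂m : ℝ) : ℂ) := by
        intro m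
        simpa using integral_ofReal (𝕜 := ℂ) (μ := m) (f := fun x : ℝ ↦ x ^ k)
      simp_rw [e]
      exact (Complex.continuous_ofReal.tendsto _).comp (hlim k)
    | succ N ih =>
      intro t ht k
      have hN : (0 : ℝ) < (N : ℝ) + 1 := by positivity
      push_cast at ht
      have h1 : |t * (N / (N + 1))| ≤ N * (1 / (2 * C)) := by
        rw [abs_mul, abs_of_nonneg (by positivity : (0 : ℝ) ≤ N / (N + 1))]
        calc |t| * (N / (N + 1)) ≤ ((N + 1) * (1 / (2 * C))) * (N / (N + 1)) := by gcongr
          _ = _ := by field_simp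
      have h2 : |t / (N + 1)| ≤ 1 / (2 * C) := by
        rw [abs_div, abs_of_pos hN, div_le_iff₀ hN]
        linarith
      -- The first summand lies in the range already covered; the second is an admissible Taylor
      -- step.
      have h3 : t = t * (N / (N + 1)) + t / (N + 1) := by field_simp
      rw [h3]
      refine tendsto_of_uniform_approx
        (a := fun J i ↦ ∑ j ∈ Finset.range J,
          (((t / (N + 1) : ℝ) : ℂ) * Complex.I) ^ j / (j.factorial : ℂ) *
          ∫ x : ℝ, (x : ℂ) ^ (k + j) *
            Complex.exp ((t * (N / (N + 1)) : ℝ) * x * Complex.I) ∂μ i)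
        (a' := fun J ↦ ∑ j ∈ Finset.range J,
          (((t / (N + 1) : ℝ) : ℂ) * Complex.I) ^ j / (j.factorial : ℂ) *
          ∫ x : ℝ, (x : ℂ) ^ (k + j) *
            Complex.exp ((t * (N / (N + 1)) : ℝ) * x * Complex.I) ∂ν)
        (r := fun J ↦ A * C ^ k * (((k + J).factorial : ℝ) / J.factorial * (1 / 2) ^ J))
        (by simpa using (tendsto_factorial_ratio k).const_mul (A * C ^ k)) ?_ ?_ ?_
      · exact fun J ↦ tendsto_finsetSum _ fun j _ ↦ (ih _ h1 _).const_mul _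
      · intro J
        filter_upwards [hμ] with i hi
        exact hi.norm_taylor_le hC h2 _ _ _
      · intro J
        exact hν.norm_taylor_le hC h2 _ _ _
  obtain ⟨N, hN⟩ := exists_nat_ge (|t| / (1 / (2 * C)))
  exact key N t ((div_le_iff₀ (by positivity)).1 hN) k

/-- Method of moments for limits with exponential-type moment bounds. -/
theorem tendsto_probabilityMeasure_of_moments {ι : Type*} {l : Filter ι} [l.IsCountablyGenerated]
    {μ : ι → ProbabilityMeasure ℝ} {ν : ProbabilityMeasure ℝ} {A C : ℝ} (hC : 0 < C)
    (hμ : ∀ᶠ i in l, HasMomentBound (μ i) A C) (hν : HasMomentBound ν A C)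
    (hlim : ∀ n : ℕ, Tendsto (fun i ↦ ∫ x, x ^ n ∂(μ i : Measure ℝ)) l
      (𝓝 (∫ x, x ^ n ∂(ν : Measure ℝ)))) : Tendsto μ l (𝓝 ν) := by
  refine tendsto_of_seq_tendsto fun u hu ↦ ?_
  refine ProbabilityMeasure.tendsto_of_tendsto_charFun fun t ↦ ?_
  have := (tendsto_integral_pow_mul_exp_of_moments (μ := fun i ↦ (μ i : Measure ℝ))
    hC hμ hν hlim t 0).comp hu
  simpa [charFun_apply_real, Function.comp_def] using this

/-! ### Powers of a tail integral -/

/-- Tonelli form of `d/dt (∫_t^∞ f)^(n+1) = -(n+1) f(t) (∫_t^∞ f)^n`. -/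
lemma lintegral_Ici_pow_succ {f : ℝ → ℝ≥0∞} (hf : Measurable f) (n : ℕ) (c : ℝ) :
    (∫⁻ t in Set.Ici c, f t) ^ (n + 1) =
      (n + 1) * ∫⁻ t in Set.Ici c, f t * (∫⁻ s in Set.Ici t, f s) ^ n := by
  have hF : Measurable fun t ↦ ∫⁻ s in Set.Ici t, f s :=
    Antitone.measurable fun s t hst ↦ lintegral_mono_set (Set.Ici_subset_Ici.2 hst)
  induction n generalizing c with
  | zero => simp
  | succ n ih =>
    set F : ℝ → ℝ≥0∞ := fun t ↦ ∫⁻ s in Set.Ici t, f s with hFdef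
    -- One factor `F c` is split at `t` as `∫_c^t f + F t`. By Tonelli the first piece becomes `∫
    -- f(s) ∫_s^∞ f F^n`, which the induction hypothesis turns into one more copy of `∫ f F^(n+1)`.
    -- Only additions occur, so infinite values do no harm.
    have hswap : ∫⁻ t in Set.Ici c, f t * F t ^ n * ∫⁻ s in Set.Ico c t, f s =
        ∫⁻ s in Set.Ici c, f s * ∫⁻ t in Set.Ici s, f t * F t ^ n := by
      have e1 : ∀ t, f t * F t ^ n * ∫⁻ s in Set.Ico c t, f s =
          ∫⁻ s in Set.Ici c, (Set.Ioi s).indicator (fun t ↦ f t * F t ^ n * f s) t := by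
        intro t
        rw [← lintegral_const_mul _ hf]
        have : ∀ s, (Set.Ioi s).indicator (fun t ↦ f t * F t ^ n * f s) t
            = (Set.Iio t).indicator (fun s ↦ f t * F t ^ n * f s) s := by
          intro s
          simp [Set.indicator_apply]
        simp_rw [this]
        rw [setLIntegral_indicator measurableSet_Iio, Set.inter_comm, Set.Ici_inter_Iio]
      simp_rw [e1]
      rw [lintegral_lintegral_swap]
      · refine setLIntegral_congr_fun measurableSet_Ici fun s hs ↦ ?_
        rw [setLIntegral_indicator measurableSet_Ioi, Set.inter_eq_left.2
          (Set.Ioi_subset_Ici hs), ← lintegral_const_mul _ (by fun_prop),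
          setLIntegral_congr Ioi_ae_eq_Ici]
        simp_rw [mul_comm (f s)]
      · refine Measurable.aemeasurable ?_
        have : (Function.uncurry fun t s ↦ (Set.Ioi s).indicator (fun t ↦ f t * F t ^ n * f s) t)
            = {p : ℝ × ℝ | p.2 < p.1}.indicator (fun p ↦ f p.1 * F p.1 ^ n * f p.2) := by
          ext p
          simp [Set.indicator_apply, Function.uncurry]
        rw [this]
        exact Measurable.indicator (by fun_prop) (measurableSet_lt measurable_snd measurable_fst)
    have hsplit : ∀ t ∈ Set.Ici c, F c = (∫⁻ s in Set.Ico c t, f s) + F t := by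
      intro t ht
      rw [hFdef]
      simp only
      rw [← lintegral_union measurableSet_Ici, Set.Ico_union_Ici_eq_Ici ht]
      exact Set.disjoint_left.2 fun x hx hx' ↦ absurd hx.2 (not_lt.2 hx')
    have hF1 : ∫⁻ s in Set.Ici c, f s * ((n + 1 : ℝ≥0∞) * ∫⁻ t in Set.Ici s, f t * F t ^ n)
        = ∫⁻ s in Set.Ici c, f s * F s ^ (n + 1) :=
      lintegral_congr fun s ↦ by rw [← ih s]
    have hmeas : Measurable fun s ↦ ∫⁻ t in Set.Ici s, f t * F t ^ n :=
      Antitone.measurable fun s t hst ↦ lintegral_mono_set (Set.Ici_subset_Ici.2 hst)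
    calc F c ^ (n + 1 + 1) = (n + 1) * (∫⁻ t in Set.Ici c, f t * F t ^ n * F c) := by
          have ihc : F c ^ (n + 1) = (n + 1) * ∫⁻ t in Set.Ici c, f t * F t ^ n := ih c
          rw [pow_succ, ihc, mul_assoc, ← lintegral_mul_const _ (by fun_prop)]
      _ = (n + 1) * (∫⁻ t in Set.Ici c, (f t * F t ^ n * (∫⁻ s in Set.Ico c t, f s)
            + f t * F t ^ (n + 1))) := by
          congr 1
          refine setLIntegral_congr_fun measurableSet_Ici fun t ht ↦ ?_
          rw [hsplit t ht]
          ring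
      _ = (n + 1) * (∫⁻ s in Set.Ici c, f s * ∫⁻ t in Set.Ici s, f t * F t ^ n)
            + (n + 1) * ∫⁻ t in Set.Ici c, f t * F t ^ (n + 1) := by
          rw [lintegral_add_right _ (by fun_prop), hswap, mul_add]
      _ = (∫⁻ s in Set.Ici c, f s * F s ^ (n + 1))
            + (n + 1) * ∫⁻ t in Set.Ici c, f t * F t ^ (n + 1) := by
          congr 1
          rw [← hF1, ← lintegral_const_mul _ (by fun_prop)]
          refine lintegral_congr fun s ↦ ?_
          ring
      _ = _ := by
          simp only [hFdef]
          push_cast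
          ring

/-! ### The Green kernel near the origin -/

/-- The Green kernel of Brownian motion with drift `-b`, restricted to times after `c`:
`∫_c^∞ p_t(u + b t) dt`. -/
noncomputable def greenKernel (b c u : ℝ) : ℝ≥0∞ :=
  ∫⁻ t in Set.Ioi c, gaussianPDF 0 t.toNNReal (u + b * t)

/-- A lower bound for `greenKernel b c` on `[-η, η]`. -/
noncomputable def greenLower (b c η : ℝ) : ℝ≥0∞ :=
  ENNReal.ofReal (Real.exp (-(b * η))) * ∫⁻ t in Set.Ioi c,
    ENNReal.ofReal (Real.exp (-(η ^ 2 / (2 * t)))) * gaussianPDF 0 t.toNNReal (b * t)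

/-- Complete the square: `(u + b t)² / (2t) = b u + u² / (2t) + (b t)² / (2t)`. The factor `exp(-b
u)` is free of `t`, and the middle one is at most `1`. -/
lemma gaussianPDF_add_drift {b t : ℝ} (ht : 0 < t) (u : ℝ) :
    gaussianPDF 0 t.toNNReal (u + b * t) = ENNReal.ofReal (Real.exp (-(b * u))) *
      (ENNReal.ofReal (Real.exp (-(u ^ 2 / (2 * t)))) * gaussianPDF 0 t.toNNReal (b * t)) := by
  rw [gaussianPDF, gaussianPDF, ← ENNReal.ofReal_mul (Real.exp_nonneg _),
    ← ENNReal.ofReal_mul (Real.exp_nonneg _), gaussianPDFReal, gaussianPDFReal]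
  congr 1
  rw [Real.coe_toNNReal _ ht.le, mul_left_comm (Real.exp (-(u ^ 2 / (2 * t)))),
    mul_left_comm (Real.exp (-(b * u))), ← Real.exp_add, ← Real.exp_add]
  congr 2
  field_simp
  ring

lemma measurable_gaussianPDF_line (u b : ℝ) :
    Measurable fun t : ℝ ↦ gaussianPDF 0 t.toNNReal (u + b * t) :=
  measurable_uncurry_gaussianPDF.comp (by fun_prop : Measurable fun t : ℝ ↦
    ((0 : ℝ), t.toNNReal, u + b * t))

lemma measurable_gaussianPDF_ray (b : ℝ) :
    Measurable fun t : ℝ ↦ gaussianPDF 0 t.toNNReal (b * t) := by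
  simpa using measurable_gaussianPDF_line 0 b

lemma greenKernel_le {b c η u : ℝ} (hb : 0 < b) (hc : 0 ≤ c) (hu : |u| ≤ η) :
    greenKernel b c u ≤ ENNReal.ofReal (Real.exp (b * η)) * greenKernel b c 0 := by
  rw [greenKernel, greenKernel, ← lintegral_const_mul _ (measurable_gaussianPDF_line 0 b)]
  refine setLIntegral_mono' measurableSet_Ioi fun t ht ↦ ?_
  have ht0 : 0 < t := hc.trans_lt ht
  rw [gaussianPDF_add_drift ht0, zero_add]
  gcongr
  · nlinarith [neg_abs_le u]
  · refine mul_le_of_le_one_left' ?_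
    rw [ENNReal.ofReal_le_one, Real.exp_le_one_iff, neg_nonpos]
    positivity

lemma greenLower_le {b c η u : ℝ} (hb : 0 < b) (hc : 0 ≤ c) (hu : |u| ≤ η) :
    greenLower b c η ≤ greenKernel b c u := by
  have hm := measurable_gaussianPDF_ray b
  rw [greenKernel, greenLower, ← lintegral_const_mul _ (by fun_prop)]
  refine setLIntegral_mono' measurableSet_Ioi fun t ht ↦ ?_
  have ht0 : 0 < t := hc.trans_lt ht
  rw [gaussianPDF_add_drift ht0]
  gcongr ENNReal.ofReal (Real.exp ?_) * (ENNReal.ofReal (Real.exp ?_) * _)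
  · nlinarith [le_abs_self u]
  · rw [neg_le_neg_iff]
    gcongr ?_ / _
    exact sq_le_sq' (by linarith [neg_abs_le u]) (by linarith [le_abs_self u])

/-- Dominated convergence, with the integrand at `η = 0` as the dominating function. -/
lemma tendsto_greenLower {b c : ℝ} (hfin : greenKernel b c 0 ≠ ∞) (hc : 0 ≤ c) :
    Tendsto (greenLower b c) (𝓝 0) (𝓝 (greenKernel b c 0)) := by
  have hm := measurable_gaussianPDF_ray b
  have h1 : Tendsto (fun η : ℝ ↦ ENNReal.ofReal (Real.exp (-(b * η)))) (𝓝 0) (𝓝 1) := by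
    have : Continuous fun η : ℝ ↦ ENNReal.ofReal (Real.exp (-(b * η))) :=
      ENNReal.continuous_ofReal.comp (by fun_prop)
    simpa using this.tendsto 0
  have h2 : Tendsto (fun η : ℝ ↦ ∫⁻ t in Set.Ioi c,
      ENNReal.ofReal (Real.exp (-(η ^ 2 / (2 * t)))) * gaussianPDF 0 t.toNNReal (b * t)) (𝓝 0)
      (𝓝 (greenKernel b c 0)) := by
    refine tendsto_lintegral_filter_of_dominated_convergence
      (fun t ↦ gaussianPDF 0 t.toNNReal (b * t)) (.of_forall fun η ↦ by fun_prop)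
      (.of_forall fun η ↦ ?_) (by simpa [greenKernel] using hfin) ?_
    · refine (ae_restrict_iff' measurableSet_Ioi).2 (ae_of_all _ fun t ht ↦ ?_)
      have ht0 : 0 < t := hc.trans_lt ht
      refine mul_le_of_le_one_left' ?_
      rw [ENNReal.ofReal_le_one, Real.exp_le_one_iff, neg_nonpos]
      positivity
    · refine ae_of_all _ fun t ↦ ?_
      have : Continuous fun η : ℝ ↦ ENNReal.ofReal (Real.exp (-(η ^ 2 / (2 * t)))) :=
        ENNReal.continuous_ofReal.comp (by fun_prop)
      have h3 := ENNReal.Tendsto.mul_const (b := gaussianPDF 0 t.toNNReal (b * t))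
        (this.tendsto 0) (Or.inr gaussianPDF_ne_top)
      simpa using h3
  have h3 := ENNReal.Tendsto.mul h1 (Or.inl one_ne_zero) h2 (Or.inr ENNReal.one_ne_top)
  rwa [one_mul] at h3

/-! ### The normal distribution function and the kernel at the origin -/

lemma stdNormalCDF_eq_integral (u : ℝ) :
    stdNormalCDF u = ∫ x in Set.Iic u, gaussianPDFReal 0 1 x := by
  rw [stdNormalCDF, cdf_eq_real, Measure.real, gaussianReal_apply_eq_integral _ one_ne_zero,
    ENNReal.toReal_ofReal (integral_nonneg fun x ↦ gaussianPDFReal_nonneg _ _ _)]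

lemma continuous_gaussianPDFReal (m : ℝ) (v : ℝ≥0) : Continuous (gaussianPDFReal m v) := by
  unfold gaussianPDFReal
  fun_prop

lemma hasDerivAt_stdNormalCDF (u : ℝ) :
    HasDerivAt stdNormalCDF (gaussianPDFReal 0 1 u) u := by
  have hi := integrable_gaussianPDFReal 0 1
  have h1 : stdNormalCDF = fun u ↦ stdNormalCDF 0 + ∫ x in (0 : ℝ)..u, gaussianPDFReal 0 1 x := by
    ext v
    rw [stdNormalCDF_eq_integral, stdNormalCDF_eq_integral,
      ← intervalIntegral.integral_Iic_sub_Iic hi.integrableOn hi.integrableOn]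
    ring
  rw [h1]
  exact (intervalIntegral.integral_hasDerivAt_right hi.intervalIntegrable
    (continuous_gaussianPDFReal 0 1).stronglyMeasurable.stronglyMeasurableAtFilter
    (continuous_gaussianPDFReal 0 1).continuousAt).const_add _

/-- The integrand `exp(-b² t / 2) / √(2πt)` has antiderivative `(2/b) Φ(b√t)`, which tends to `2/b`
at infinity. -/
lemma greenKernel_zero {b c : ℝ} (hb : 0 < b) (hc : 0 ≤ c) :
    greenKernel b c 0 = ENNReal.ofReal (tailWeight (b * √c) / b) := by
  have hcont : Continuous fun t : ℝ ↦ 2 / b * stdNormalCDF (b * √t) := by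
    have : Continuous stdNormalCDF :=
      continuous_iff_continuousAt.2 fun u ↦ (hasDerivAt_stdNormalCDF u).continuousAt
    fun_prop
  have hderiv : ∀ t ∈ Set.Ioi c, HasDerivAt (fun t : ℝ ↦ 2 / b * stdNormalCDF (b * √t))
      (gaussianPDFReal 0 t.toNNReal (b * t)) t := by
    intro t ht
    have ht0 : 0 < t := hc.trans_lt ht
    have h1 : HasDerivAt (fun t : ℝ ↦ b * √t) (b * (1 / (2 * √t))) t :=
      (Real.hasDerivAt_sqrt ht0.ne').const_mul b
    refine (((hasDerivAt_stdNormalCDF _).comp t h1).const_mul (2 / b)).congr_deriv ?_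
    rw [gaussianPDFReal, gaussianPDFReal, Real.coe_toNNReal _ ht0.le]
    have hs : 0 < √t := Real.sqrt_pos.2 ht0
    have e1 : -(b * √t - 0) ^ 2 / (2 * ((1 : ℝ≥0) : ℝ)) = -(b * t - 0) ^ 2 / (2 * t) := by
      rw [sub_zero, sub_zero, mul_pow, Real.sq_sqrt ht0.le, NNReal.coe_one]
      field_simp
    rw [e1, Real.sqrt_mul (by positivity) t, NNReal.coe_one, mul_one]
    field_simp
  have hlim : Tendsto (fun t : ℝ ↦ 2 / b * stdNormalCDF (b * √t)) atTop (𝓝 (2 / b * 1)) :=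
    ((tendsto_cdf_atTop (gaussianReal 0 1)).comp
      (Real.tendsto_sqrt_atTop.const_mul_atTop hb)).const_mul _
  have hpos : ∀ t ∈ Set.Ioi c, 0 ≤ gaussianPDFReal 0 t.toNNReal (b * t) :=
    fun t _ ↦ gaussianPDFReal_nonneg _ _ _
  have hint := integrableOn_Ioi_deriv_of_nonneg hcont.continuousWithinAt hderiv hpos hlim
  have hval := integral_Ioi_of_hasDerivAt_of_nonneg hcont.continuousWithinAt hderiv hpos hlim
  rw [greenKernel]
  simp only [zero_add, gaussianPDF]
  rw [← ofReal_integral_eq_lintegral_ofReal hint (ae_of_all _ fun t ↦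
    gaussianPDFReal_nonneg _ _ _), hval, tailWeight]
  congr 1
  field_simp

lemma stdNormalCDF_neg (u : ℝ) : stdNormalCDF (-u) = 1 - stdNormalCDF u := by
  have := nullSingletonClass_gaussianReal (μ := 0) (one_ne_zero : (1 : ℝ≥0) ≠ 0)
  have h : (gaussianReal 0 1) (Set.Iic (-u)) = (gaussianReal 0 1) (Set.Ici u) := by
    have e := gaussianReal_map_neg (μ := 0) (v := 1)
    rw [neg_zero] at e
    conv_lhs => rw [← e]
    rw [Measure.map_apply measurable_neg measurableSet_Iic]
    congr 1
    ext x
    simp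
  have h2 := probReal_compl_eq_one_sub (μ := gaussianReal 0 1) (measurableSet_Iic (a := u))
  rw [stdNormalCDF, stdNormalCDF, cdf_eq_real, cdf_eq_real, ← h2, Measure.real, Measure.real, h,
    Set.compl_Iic, measure_congr Ioi_ae_eq_Ici]

lemma tailWeight_zero : tailWeight 0 = 1 := by
  have := stdNormalCDF_neg 0
  rw [neg_zero] at this
  rw [tailWeight]
  linarith

lemma tailWeight_nonneg (u : ℝ) : 0 ≤ tailWeight u := by
  have := cdf_le_one (gaussianReal 0 1) u
  rw [tailWeight, stdNormalCDF]
  linarith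

lemma tailWeight_le_one {u : ℝ} (hu : 0 ≤ u) : tailWeight u ≤ 1 := by
  have := monotone_cdf (gaussianReal 0 1) hu
  have h0 := tailWeight_zero
  simp only [tailWeight, stdNormalCDF] at h0 ⊢
  linarith

lemma greenKernel_zero_zero {b : ℝ} (hb : 0 < b) :
    greenKernel b 0 0 = ENNReal.ofReal (1 / b) := by
  rw [greenKernel_zero hb le_rfl, Real.sqrt_zero, mul_zero, tailWeight_zero]

/-! ### Occupation time of the strip -/

/-- The function `ε⁻¹ 1_[-ε/2, ε/2]`. -/
noncomputable def stripDensity (ε x : ℝ) : ℝ≥0∞ :=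
  (Set.Icc (-(ε / 2)) (ε / 2)).indicator (fun _ ↦ ENNReal.ofReal (1 / ε)) x

@[fun_prop]
lemma measurable_stripDensity (ε : ℝ) : Measurable (stripDensity ε) :=
  measurable_const.indicator measurableSet_Icc

lemma abs_le_of_stripDensity_ne_zero {ε x : ℝ} (h : stripDensity ε x ≠ 0) : |x| ≤ ε / 2 :=
  abs_le.2 (Set.mem_of_indicator_ne_zero (s := Set.Icc (-(ε / 2)) (ε / 2))
    (f := fun _ ↦ ENNReal.ofReal (1 / ε)) h)

lemma lintegral_stripDensity {ε : ℝ} (hε : 0 < ε) : ∫⁻ x, stripDensity ε x = 1 := by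
  simp only [stripDensity]
  rw [lintegral_indicator_const measurableSet_Icc, Real.volume_Icc,
    ← ENNReal.ofReal_mul (by positivity)]
  have : 1 / ε * (ε / 2 - -(ε / 2)) = 1 := by field_simp; ring
  rw [this, ENNReal.ofReal_one]

/-- Normalised time spent in `[-ε/2, ε/2]` after time `c` by `x + f t - b t`. -/
noncomputable def occupation (f : ℝ≥0 → ℝ) (b ε c x : ℝ) : ℝ≥0∞ :=
  ∫⁻ t in Set.Ici c, stripDensity ε (x + f t.toNNReal - b * t)

lemma relativeTime_eq_occupation {Ω : Type*} (W : ℝ≥0 → Ω → ℝ) (c : ℝ≥0) (b ε : ℝ) (ω : Ω)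
    (hW : Continuous fun t ↦ W t ω) :
    relativeTime W c b ε ω = occupation (fun t ↦ W t ω) b ε c 0 := by
  have hc : Continuous fun t : ℝ ↦ W t.toNNReal ω := hW.comp continuous_real_toNNReal
  rw [relativeTime, occupation, ← lintegral_const_mul]
  · refine lintegral_congr fun t ↦ ?_
    simp only [stripDensity, Set.indicator_apply, Set.mem_ofPred_eq, Set.mem_Icc, Pi.one_apply]
    split_ifs with h1 h2 h2
    · simp
    · exact absurd ⟨by linarith, by linarith⟩ h2
    · exact absurd ⟨by linarith, by linarith⟩ h1
    · simp
  · exact measurable_one.indicator ((measurableSet_le (by fun_prop) hc.measurable).inter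
      (measurableSet_le hc.measurable (by fun_prop)))

/-- The occupation after `t` is that of the restarted path of increments, issued from its current
position relative to the ray; this is the form the Markov property needs. -/
lemma occupation_shift (f : ℝ≥0 → ℝ) (b ε y : ℝ) (t : ℝ≥0) :
    occupation f b ε t y =
      occupation (fun s ↦ f (t + s) - f t) b ε 0 (y + f t - b * t) := by
  rw [occupation, occupation, ← lintegral_indicator measurableSet_Ici,
    ← lintegral_indicator measurableSet_Ici, ← lintegral_add_left_eq_self _ (t : ℝ)]
  refine lintegral_congr fun s ↦ ?_
  simp only [Set.indicator_apply, Set.mem_Ici, le_add_iff_nonneg_right]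
  split_ifs with h
  · rw [Real.toNNReal_add t.coe_nonneg h, Real.toNNReal_coe]
    congr 1
    ring
  · rfl

/-- Joint measurability serves both Tonelli in time and the Markov property; `α` is taken to be
either `Ω` or the space of continuous paths. -/
lemma measurable_occupation {α : Type*} [MeasurableSpace α] {u : ℝ≥0 → α → ℝ}
    (hu : ∀ t, Measurable (u t)) (hc : ∀ a, Continuous fun t ↦ u t a) (b ε : ℝ) :
    Measurable fun p : ℝ × ℝ × α ↦ occupation (fun t ↦ u t p.2.2) b ε p.1 p.2.1 := by
  have hm : Measurable (Function.uncurry u) := measurable_uncurry_of_continuous_of_measurable hc hu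
  simp only [occupation]
  simp_rw [← lintegral_indicator measurableSet_Ici]
  have h : Measurable fun q : (ℝ × ℝ × α) × ℝ ↦ {q : (ℝ × ℝ × α) × ℝ | q.1.1 ≤ q.2}.indicator
      (fun q ↦ stripDensity ε (q.1.2.1 + u q.2.toNNReal q.1.2.2 - b * q.2)) q := by
    refine Measurable.indicator ?_ (measurableSet_le (by fun_prop) (by fun_prop))
    have : Measurable fun q : (ℝ × ℝ × α) × ℝ ↦ u q.2.toNNReal q.1.2.2 :=
      hm.comp (by fun_prop : Measurable fun q : (ℝ × ℝ × α) × ℝ ↦ (q.2.toNNReal, q.1.2.2))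
    fun_prop
  exact h.lintegral_prod_right'

/-! ### Markov property and moments of the occupation time -/

/-- A Brownian motion all of whose paths are continuous and all of whose marginals are
measurable. -/
structure IsStrictBrownian {Ω : Type*} [MeasurableSpace Ω] (B : ℝ≥0 → Ω → ℝ) (P : Measure Ω) :
    Prop extends IsPreBrownianReal B P where
  measurable : ∀ t, Measurable (B t)
  continuous : ∀ ω, Continuous fun t ↦ B t ω

section

variable {Ω : Type*} [MeasurableSpace Ω] {P : Measure Ω} {B : ℝ≥0 → Ω → ℝ}

lemma IsStrictBrownian.shift (hB : IsStrictBrownian B P) (t : ℝ≥0) :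
    IsStrictBrownian (fun s ω ↦ B (t + s) ω - B t ω) P where
  toIsPreBrownianReal := hB.toIsPreBrownianReal.shift t
  measurable s := (hB.measurable _).sub (hB.measurable _)
  continuous ω := by
    have := hB.continuous ω
    fun_prop

/-- Markov property: a functional of `B t` and the path after `t` is integrated by freezing
`B t`. -/
lemma IsStrictBrownian.lintegral_markov [IsProbabilityMeasure P] (hB : IsStrictBrownian B P)
    (t : ℝ≥0) {g : ℝ → {f : ℝ≥0 → ℝ // Continuous f} → ℝ≥0∞} (hg : Measurable (Function.uncurry g)) :
    ∫⁻ ω, g (B t ω) ⟨fun s ↦ B (t + s) ω - B t ω, (hB.shift t).continuous ω⟩ ∂P =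
      ∫⁻ ω, ∫⁻ ω', g (B t ω) ⟨fun s ↦ B (t + s) ω' - B t ω', (hB.shift t).continuous ω'⟩ ∂P ∂P := by
  set Y : Ω → {f : ℝ≥0 → ℝ // Continuous f} :=
    fun ω ↦ ⟨fun s ↦ B (t + s) ω - B t ω, (hB.shift t).continuous ω⟩ with hY
  have hYm : Measurable Y :=
    (measurable_pi_lambda _ fun s ↦ (hB.shift t).measurable s).subtype_mk
  have h0 : IndepFun (fun ω s ↦ B (t + s) ω - B t ω) (B t) P := by
    have := hB.toIsPreBrownianReal.indepFun_shift t
    exact this.comp measurable_id (measurable_pi_apply (⟨t, Set.mem_Iic.2 le_rfl⟩ : Set.Iic t))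
  have h1 : IndepFun (B t) Y P := by
    refine IndepFun.symm ?_
    -- The σ-algebra on continuous paths is pulled back along the inclusion, so `Y` generates the
    -- same σ-algebra as the raw path.
    rw [IndepFun_iff_Indep] at h0 ⊢
    convert h0 using 1
    exact MeasurableSpace.comap_comp
  have h2 := (indepFun_iff_map_prod_eq_prod_map_map (hB.measurable t).aemeasurable
    hYm.aemeasurable).1 h1
  have := Measure.isProbabilityMeasure_map (μ := P) hYm.aemeasurable
  calc ∫⁻ ω, g (B t ω) (Y ω) ∂P
      = ∫⁻ p, Function.uncurry g p ∂(P.map fun ω ↦ (B t ω, Y ω)) :=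
        (lintegral_map hg ((hB.measurable t).prodMk hYm)).symm
    _ = ∫⁻ x, ∫⁻ e, Function.uncurry g (x, e) ∂(P.map Y) ∂(P.map (B t)) := by
        rw [h2, lintegral_prod _ hg.aemeasurable]
    _ = ∫⁻ ω, ∫⁻ e, Function.uncurry g (B t ω, e) ∂(P.map Y) ∂P :=
        lintegral_map hg.lintegral_prod_right' (hB.measurable t)
    _ = _ := by
        refine lintegral_congr fun ω ↦ ?_
        exact lintegral_map (hg.comp (measurable_prodMk_left (x := B t ω))) hYm

/-- Kac's moment recursion: expand the power by the tail-integral identity, then condition at time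
`t` and restart from the current position. -/
lemma IsStrictBrownian.lintegral_occupation_pow_succ [IsProbabilityMeasure P]
    (hB : IsStrictBrownian B P) (b ε : ℝ) {c : ℝ} (hc : 0 ≤ c) (y : ℝ) (n : ℕ) :
    ∫⁻ ω, occupation (fun t ↦ B t ω) b ε c y ^ (n + 1) ∂P =
      (n + 1) * ∫⁻ t in Set.Ici c, ∫⁻ ω, stripDensity ε (y + B t.toNNReal ω - b * t) *
        ∫⁻ ω', occupation (fun s ↦ B (t.toNNReal + s) ω' - B t.toNNReal ω') b ε 0
          (y + B t.toNNReal ω - b * t) ^ n ∂P ∂P := by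
  have hm : Measurable (Function.uncurry B) :=
    measurable_uncurry_of_continuous_of_measurable hB.continuous hB.measurable
  have hmo := measurable_occupation hB.measurable hB.continuous b ε
  have hj : Measurable fun p : ℝ × Ω ↦ stripDensity ε (y + B p.1.toNNReal p.2 - b * p.1) := by
    have : Measurable fun p : ℝ × Ω ↦ B p.1.toNNReal p.2 :=
      hm.comp (by fun_prop : Measurable fun p : ℝ × Ω ↦ (p.1.toNNReal, p.2))
    fun_prop
  calc ∫⁻ ω, occupation (fun t ↦ B t ω) b ε c y ^ (n + 1) ∂P
      = ∫⁻ ω, (n + 1) * (∫⁻ t in Set.Ici c, stripDensity ε (y + B t.toNNReal ω - b * t) *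
          occupation (fun t ↦ B t ω) b ε t y ^ n) ∂P := by
        refine lintegral_congr fun ω ↦ ?_
        exact lintegral_Ici_pow_succ (hj.comp measurable_prodMk_right) n c
    _ = (n + 1) * ∫⁻ t in Set.Ici c, ∫⁻ ω, stripDensity ε (y + B t.toNNReal ω - b * t) *
          occupation (fun t ↦ B t ω) b ε t y ^ n ∂P := by
        have hjj : Measurable fun p : Ω × ℝ ↦ stripDensity ε (y + B p.2.toNNReal p.1 - b * p.2) *
            occupation (fun t ↦ B t p.1) b ε p.2 y ^ n :=
          (hj.comp measurable_swap).mul ((hmo.comp (by fun_prop :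
            Measurable fun p : Ω × ℝ ↦ (p.2, y, p.1))).pow_const n)
        rw [lintegral_const_mul _ hjj.lintegral_prod_right', lintegral_lintegral_swap
          hjj.aemeasurable]
    _ = _ := by
        congr 1
        refine setLIntegral_congr_fun measurableSet_Ici fun t ht ↦ ?_
        have ht0 : 0 ≤ t := hc.trans ht
        have hg : Measurable (Function.uncurry fun (x : ℝ) (f : {f : ℝ≥0 → ℝ // Continuous f}) ↦
            stripDensity ε (y + x - b * t) * occupation f.1 b ε 0 (y + x - b * t) ^ n) := by
          have h1 := measurable_occupation (α := {f : ℝ≥0 → ℝ // Continuous f})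
            (u := fun s f ↦ f.1 s) (fun s ↦ (measurable_pi_apply s).comp measurable_subtype_coe)
            (fun f ↦ f.2) b ε
          have h2 := h1.comp (by fun_prop : Measurable fun p : ℝ × {f : ℝ≥0 → ℝ // Continuous f} ↦
            ((0 : ℝ), y + p.1 - b * t, p.2))
          exact Measurable.mul (by fun_prop) (h2.pow_const n)
        have h := hB.lintegral_markov t.toNNReal hg
        simp only at h
        have e : ∀ ω, occupation (fun t ↦ B t ω) b ε t y = occupation
            (fun s ↦ B (t.toNNReal + s) ω - B t.toNNReal ω) b ε 0 (y + B t.toNNReal ω - b * t) := by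
          intro ω
          have := occupation_shift (fun t ↦ B t ω) b ε y t.toNNReal
          rwa [Real.coe_toNNReal _ ht0] at this
        simp_rw [e]
        rw [h]
        refine lintegral_congr fun ω ↦ ?_
        rw [lintegral_const_mul]
        have hms := measurable_occupation (hB.shift t.toNNReal).measurable
          (hB.shift t.toNNReal).continuous b ε
        exact (hms.comp (by fun_prop : Measurable fun ω' : Ω ↦
          ((0 : ℝ), y + B t.toNNReal ω - b * t, ω'))).pow_const n

lemma IsStrictBrownian.lintegral_stripDensity (hB : IsStrictBrownian B P) (b ε y : ℝ) {t : ℝ}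
    (ht : 0 < t) :
    ∫⁻ ω, stripDensity ε (y + B t.toNNReal ω - b * t) ∂P =
      ∫⁻ x, stripDensity ε x * gaussianPDF 0 t.toNNReal (x - y + b * t) := by
  have h1 : ∫⁻ ω, stripDensity ε (y + B t.toNNReal ω - b * t) ∂P
      = ∫⁻ z, stripDensity ε (y + z - b * t) ∂(P.map (B t.toNNReal)) :=
    (lintegral_map (f := fun z ↦ stripDensity ε (y + z - b * t)) (by fun_prop)
      (hB.measurable _)).symm
  have hv : t.toNNReal ≠ 0 := by simpa using ht
  rw [h1, (hB.toIsPreBrownianReal.hasLaw_eval _).map_eq, gaussianReal_of_var_ne_zero _ hv,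
    lintegral_withDensity_eq_lintegral_mul _ (measurable_gaussianPDF _ _) (by fun_prop),
    ← lintegral_add_right_eq_self _ (-y + b * t)]
  refine lintegral_congr fun x ↦ ?_
  simp only [Pi.mul_apply]
  rw [mul_comm]
  ring_nf

lemma IsStrictBrownian.lintegral_occupation [IsProbabilityMeasure P]
    (hB : IsStrictBrownian B P) (b ε : ℝ) {c : ℝ} (hc : 0 ≤ c) (y : ℝ) :
    ∫⁻ ω, occupation (fun t ↦ B t ω) b ε c y ∂P =
      ∫⁻ x, stripDensity ε x * greenKernel b c (x - y) := by
  have h := hB.lintegral_occupation_pow_succ b ε hc y 0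
  simp only [zero_add, pow_one, pow_zero, Nat.cast_zero, lintegral_const, measure_univ,
    mul_one, one_mul] at h
  -- Time `0`, where the Gaussian law has no density, is discarded as a null set.
  rw [h, setLIntegral_congr Ioi_ae_eq_Ici.symm, setLIntegral_congr_fun measurableSet_Ioi
    fun t ht ↦ hB.lintegral_stripDensity b ε y (hc.trans_lt ht), lintegral_lintegral_swap]
  · refine lintegral_congr fun x ↦ ?_
    rw [lintegral_const_mul _ (measurable_gaussianPDF_line _ _), greenKernel]
  · have : Measurable fun p : ℝ × ℝ ↦ gaussianPDF 0 p.1.toNNReal (p.2 - y + b * p.1) :=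
      measurable_uncurry_gaussianPDF.comp (by fun_prop : Measurable fun p : ℝ × ℝ ↦
        ((0 : ℝ), p.1.toNNReal, p.2 - y + b * p.1))
    exact Measurable.aemeasurable (by fun_prop)

/-- An upper bound for `greenKernel b c` on `[-η, η]`. -/
noncomputable def greenUpper (b c η : ℝ) : ℝ≥0∞ :=
  ENNReal.ofReal (Real.exp (b * η)) * greenKernel b c 0

/-- Both `x` and `y` lie within `ε / 2` of `0`, so the kernel is evaluated at distance at most `ε`;
hence the argument `ε` in the bounds. -/
lemma IsStrictBrownian.lintegral_occupation_mem [IsProbabilityMeasure P]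
    (hB : IsStrictBrownian B P) {b ε : ℝ} (hb : 0 < b) (hε : 0 < ε) {c : ℝ} (hc : 0 ≤ c) {y : ℝ}
    (hy : |y| ≤ ε / 2) :
    ∫⁻ ω, occupation (fun t ↦ B t ω) b ε c y ∂P ∈
      Set.Icc (greenLower b c ε) (greenUpper b c ε) := by
  have hu : ∀ x, stripDensity ε x ≠ 0 → |x - y| ≤ ε := fun x hx ↦
    (abs_sub x y).trans (by linarith [abs_le_of_stripDensity_ne_zero hx])
  rw [hB.lintegral_occupation b ε hc y]
  constructor
  · calc greenLower b c ε = ∫⁻ x, stripDensity ε x * greenLower b c ε := by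
          rw [lintegral_mul_const _ (by fun_prop), _root_.lintegral_stripDensity hε, one_mul]
      _ ≤ _ := by
          refine lintegral_mono fun x ↦ ?_
          by_cases hx : stripDensity ε x = 0
          · simp [hx]
          · exact mul_le_mul_right (greenLower_le hb hc (hu x hx)) _
  · calc _ ≤ ∫⁻ x, stripDensity ε x * greenUpper b c ε := by
          refine lintegral_mono fun x ↦ ?_
          by_cases hx : stripDensity ε x = 0
          · simp [hx]
          · exact mul_le_mul_right (greenKernel_le hb hc (hu x hx)) _
      _ = _ := by
          rw [lintegral_mul_const _ (by fun_prop), _root_.lintegral_stripDensity hε, one_mul]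

/-- Two-sided bounds for the moments of the normalised occupation time. -/
theorem IsStrictBrownian.lintegral_occupation_pow_mem [IsProbabilityMeasure P]
    {b ε : ℝ} (hb : 0 < b) (hε : 0 < ε) (n : ℕ) {B : ℝ≥0 → Ω → ℝ} (hB : IsStrictBrownian B P)
    {c : ℝ} (hc : 0 ≤ c) {y : ℝ} (hy : |y| ≤ ε / 2) :
    ∫⁻ ω, occupation (fun t ↦ B t ω) b ε c y ^ (n + 1) ∂P ∈
      Set.Icc ((n + 1).factorial * greenLower b 0 ε ^ n * greenLower b c ε)
        ((n + 1).factorial * greenUpper b 0 ε ^ n * greenUpper b c ε) := by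
  -- The inner moment concerns the restarted motion from time `0` and a new starting point, so all
  -- three must vary.
  induction n generalizing B c y with
  | zero => simpa using hB.lintegral_occupation_mem hb hε hc hy
  | succ n ih =>
    have h1 := hB.lintegral_occupation_mem hb hε hc hy
    -- The recursion at `n = 0` identifies the outer integral with the first moment; this supplies
    -- the factor with the true `c`.
    have h2 := hB.lintegral_occupation_pow_succ b ε hc y 0
    simp only [zero_add, pow_one, pow_zero, Nat.cast_zero, lintegral_const, measure_univ,
      mul_one, one_mul] at h2
    rw [h2] at h1
    have hfac : (((n + 1 + 1).factorial : ℕ) : ℝ≥0∞) = ((n + 1 : ℕ) + 1) * (n + 1).factorial := by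
      rw [Nat.factorial_succ (n + 1)]
      push_cast
      rfl
    have hm : Measurable (Function.uncurry B) :=
      measurable_uncurry_of_continuous_of_measurable hB.continuous hB.measurable
    have hj : Measurable fun p : ℝ × Ω ↦ stripDensity ε (y + B p.1.toNNReal p.2 - b * p.1) := by
      have : Measurable fun p : ℝ × Ω ↦ B p.1.toNNReal p.2 :=
        hm.comp (by fun_prop : Measurable fun p : ℝ × Ω ↦ (p.1.toNNReal, p.2))
      fun_prop
    have hconst : ∀ K : ℝ≥0∞, ∫⁻ t in Set.Ici c, ∫⁻ ω,
        stripDensity ε (y + B t.toNNReal ω - b * t) * K ∂P =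
        (∫⁻ t in Set.Ici c, ∫⁻ ω, stripDensity ε (y + B t.toNNReal ω - b * t) ∂P) * K := by
      intro K
      rw [← lintegral_mul_const _ hj.lintegral_prod_right']
      exact lintegral_congr fun t ↦ lintegral_mul_const _ (hj.comp measurable_prodMk_left)
    rw [hB.lintegral_occupation_pow_succ b ε hc y (n + 1), hfac]
    constructor
    · calc _ = ((n + 1 : ℕ) + 1 : ℝ≥0∞) * (greenLower b c ε *
            ((n + 1).factorial * greenLower b 0 ε ^ n * greenLower b 0 ε)) := by ring
        _ ≤ _ := by
          gcongr
          refine (mul_le_mul_left h1.1 _).trans ?_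
          rw [← hconst]
          refine lintegral_mono fun t ↦ lintegral_mono fun ω ↦ ?_
          -- Where the density is nonzero the restarted motion begins inside the strip, as the
          -- induction hypothesis requires.
          by_cases hx : stripDensity ε (y + B t.toNNReal ω - b * t) = 0
          · simp [hx]
          · exact mul_le_mul_right (ih (hB.shift _) le_rfl (abs_le_of_stripDensity_ne_zero hx)).1 _
    · calc _ ≤ ((n + 1 : ℕ) + 1 : ℝ≥0∞) * (greenUpper b c ε *
            ((n + 1).factorial * greenUpper b 0 ε ^ n * greenUpper b 0 ε)) := by
            gcongr
            refine le_trans ?_ (mul_le_mul_left h1.2 _)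
            rw [← hconst]
            refine lintegral_mono fun t ↦ lintegral_mono fun ω ↦ ?_
            by_cases hx : stripDensity ε (y + B t.toNNReal ω - b * t) = 0
            · simp [hx]
            · exact mul_le_mul_right (ih (hB.shift _) le_rfl (abs_le_of_stripDensity_ne_zero hx)).2 _
        _ = _ := by ring

end

/-! ### Passage to everywhere continuous paths -/

/-- A Brownian motion agrees, off a null set, with one having only continuous paths and
measurable marginals. -/
lemma exists_isStrictBrownian {Ω : Type*} [MeasurableSpace Ω] {P : Measure Ω} {W : ℝ≥0 → Ω → ℝ}
    (hW : IsBrownianReal W P) :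
    ∃ B : ℝ≥0 → Ω → ℝ, IsStrictBrownian B P ∧ ∀ᵐ ω ∂P, ∀ t, W t ω = B t ω := by
  have hm := fun t ↦ hW.toIsPreBrownianReal.aemeasurable t
  -- Measurable versions are matched at countably many times only, so the exceptional set stays
  -- null; the other marginals are pointwise limits by continuity.
  set D := TopologicalSpace.denseSeq ℝ≥0
  have hae : ∀ᵐ ω ∂P, Continuous (fun t ↦ W t ω) ∧ ∀ n, W (D n) ω = (hm (D n)).mk _ ω :=
    hW.cont.and (ae_all_iff.2 fun n ↦ (hm (D n)).ae_eq_mk)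
  obtain ⟨A, hA, hAm, hAP⟩ := exists_measurable_superset_of_null (ae_iff.1 hae)
  have hgood : ∀ ω ∉ A, Continuous (fun t ↦ W t ω) ∧ ∀ n, W (D n) ω = (hm (D n)).mk _ ω := by
    intro ω hω
    by_contra h
    exact hω (hA h)
  have heq : ∀ᵐ ω ∂P, ∀ t, W t ω = Aᶜ.indicator (W t) ω := by
    filter_upwards [compl_mem_ae_iff.2 hAP] with ω hω t
    rw [Set.indicator_of_mem hω]
  have hcont : ∀ ω, Continuous fun t ↦ Aᶜ.indicator (W t) ω := by
    intro ω
    by_cases hω : ω ∈ A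
    · simp [hω, continuous_const]
    · simpa [hω] using (hgood ω hω).1
  refine ⟨fun t ↦ Aᶜ.indicator (W t), ⟨hW.toIsPreBrownianReal.congr fun t ↦ ?_, fun t ↦ ?_, hcont⟩,
    heq⟩
  · filter_upwards [heq] with ω hω using hω t
  · have hD : ∀ n, Measurable (Aᶜ.indicator (W (D n))) := by
      intro n
      have : Aᶜ.indicator (W (D n)) = Aᶜ.indicator ((hm (D n)).mk _) :=
        Set.indicator_congr fun ω hω ↦ (hgood ω hω).2 n
      rw [this]
      exact (hm (D n)).measurable_mk.indicator hAm.compl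
    obtain ⟨x, hx, hlim⟩ := mem_closure_iff_seq_limit.1
      ((TopologicalSpace.denseRange_denseSeq ℝ≥0) t)
    choose k hk using hx
    refine measurable_of_tendsto_metrizable (f := fun n ↦ Aᶜ.indicator (W (D (k n))))
      (fun n ↦ hD _) (tendsto_pi_nhds.2 fun ω ↦ ?_)
    have := ((hcont ω).tendsto t).comp hlim
    simpa [Function.comp_def, ← hk] using this

/-! ### Moments of the limit law -/

lemma HasMomentBound.of_lintegral {μ : Measure ℝ} {A C : ℝ} (hA : 0 ≤ A) (hC : 0 ≤ C)
    (h : ∀ n : ℕ, ∫⁻ x, ENNReal.ofReal (|x| ^ n) ∂μ ≤ ENNReal.ofReal (A * n.factorial * C ^ n)) :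
    HasMomentBound μ A C where
  integrable n := by
    refine ⟨by fun_prop, ?_⟩
    rw [hasFiniteIntegral_iff_ofReal (ae_of_all _ fun x ↦ by positivity)]
    exact (h n).trans_lt ENNReal.ofReal_lt_top
  le n := by
    rw [integral_eq_lintegral_of_nonneg_ae (ae_of_all _ fun x ↦ by positivity) (by fun_prop)]
    exact ENNReal.toReal_le_of_le_ofReal (by positivity) (h n)

lemma integral_pow_eq_toReal_lintegral {μ : Measure ℝ} (hμ : ∀ᵐ x ∂μ, 0 ≤ x) (n : ℕ) :
    ∫ x, x ^ n ∂μ = (∫⁻ x, ENNReal.ofReal (|x| ^ n) ∂μ).toReal := by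
  rw [← integral_eq_lintegral_of_nonneg_ae (ae_of_all _ fun x ↦ by positivity) (by fun_prop)]
  refine integral_congr_ae ?_
  filter_upwards [hμ] with x hx
  rw [abs_of_nonneg hx]

lemma lintegral_abs_pow_expMeasure {r : ℝ} (hr : 0 < r) (n : ℕ) :
    ∫⁻ x, ENNReal.ofReal (|x| ^ n) ∂expMeasure r = ENNReal.ofReal (n.factorial / r ^ n) := by
  have h1 : ∫⁻ x, ENNReal.ofReal (|x| ^ n) ∂expMeasure r =
      ∫⁻ x, exponentialPDF r x * ENNReal.ofReal (|x| ^ n) :=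
    lintegral_withDensity_eq_lintegral_mul _
      (measurable_exponentialPDFReal r).ennreal_ofReal (by fun_prop)
  have h2 : ∀ x, exponentialPDF r x * ENNReal.ofReal (|x| ^ n) =
      (Set.Ici 0).indicator (fun x ↦ ENNReal.ofReal
        (r * (x ^ (((n : ℝ) + 1) - 1) * Real.exp (-(r * x))))) x := by
    intro x
    by_cases hx : 0 ≤ x
    · rw [exponentialPDF_of_nonneg hx, Set.indicator_of_mem (Set.mem_Ici.2 hx),
        ← ENNReal.ofReal_mul (by positivity), add_sub_cancel_right, Real.rpow_natCast,
        abs_of_nonneg hx]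
      congr 1
      ring
    · rw [exponentialPDF_of_neg (not_le.1 hx), zero_mul,
        Set.indicator_of_notMem (by simpa using hx)]
  have h3 := Real.integral_rpow_mul_exp_neg_mul_Ioi (a := (n : ℝ) + 1) (by positivity) hr
  have h4 : IntegrableOn (fun x ↦ r * (x ^ (((n : ℝ) + 1) - 1) * Real.exp (-(r * x))))
      (Set.Ioi 0) := by
    -- A non-integrable function has Bochner integral `0`, whereas the Gamma value is positive.
    refine Integrable.const_mul (.of_integral_ne_zero ?_) _
    rw [h3]
    have := Real.Gamma_pos_of_pos (s := (n : ℝ) + 1) (by positivity)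
    positivity
  simp_rw [h1, h2]
  rw [lintegral_indicator measurableSet_Ici, setLIntegral_congr Ioi_ae_eq_Ici.symm,
    ← ofReal_integral_eq_lintegral_ofReal h4, integral_const_mul, h3, Real.Gamma_nat_eq_factorial]
  · congr 1
    rw [show ((n : ℝ) + 1) = ((n + 1 : ℕ) : ℝ) by push_cast; rfl, Real.rpow_natCast, div_pow,
      one_pow, pow_succ]
    field_simp
  · refine (ae_restrict_iff' measurableSet_Ioi).2 (ae_of_all _ fun x hx ↦ ?_)
    have : (0 : ℝ) < x := hx
    simp only [Pi.zero_apply]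
    positivity

lemma isProbabilityMeasure_limitLaw (c : ℝ≥0) {b : ℝ} (hb : b ≠ 0) :
    IsProbabilityMeasure (limitLaw c b) := by
  have := isProbabilityMeasure_expMeasure (abs_pos.2 hb)
  have h0 := tailWeight_nonneg (|b| * √(c : ℝ))
  have h1 := tailWeight_le_one (u := |b| * √(c : ℝ)) (by positivity)
  constructor
  rw [limitLaw, Measure.add_apply, Measure.smul_apply, Measure.smul_apply, measure_univ,
    measure_univ, smul_eq_mul, smul_eq_mul, mul_one, mul_one,
    ← ENNReal.ofReal_add h0 (by linarith)]
  simp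

lemma ae_nonneg_limitLaw (c : ℝ≥0) (b : ℝ) : ∀ᵐ x ∂limitLaw c b, 0 ≤ x := by
  rw [limitLaw, ae_add_measure_iff]
  refine ⟨Measure.ae_smul_measure ?_ _, Measure.ae_smul_measure ?_ _⟩
  · have h1 : expMeasure |b| = volume.withDensity (exponentialPDF |b|) := rfl
    have h2 : Measurable (exponentialPDF |b|) := (measurable_exponentialPDFReal _).ennreal_ofReal
    rw [h1, ae_withDensity_iff h2]
    refine ae_of_all _ fun x hx ↦ ?_
    by_contra h
    exact hx (exponentialPDF_of_neg (not_le.1 h))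
  · rw [ae_dirac_eq]
    simp

/-- The atom at `0` contributes nothing because the exponent is positive; order `0` is treated apart
throughout. -/
lemma lintegral_abs_pow_limitLaw (c : ℝ≥0) {b : ℝ} (hb : b ≠ 0) (n : ℕ) :
    ∫⁻ x, ENNReal.ofReal (|x| ^ (n + 1)) ∂limitLaw c b = ENNReal.ofReal
      (tailWeight (|b| * √(c : ℝ)) * ((n + 1).factorial / |b| ^ (n + 1))) := by
  rw [limitLaw, lintegral_add_measure, lintegral_smul_measure, lintegral_smul_measure,
    lintegral_abs_pow_expMeasure (abs_pos.2 hb), lintegral_dirac]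
  simp [ENNReal.ofReal_mul (tailWeight_nonneg _)]

/-- `C` is left free above `1 / |b|` so that the limit can share a constant with the occupation
times. -/
lemma hasMomentBound_limitLaw (c : ℝ≥0) {b C : ℝ} (hb : b ≠ 0) (hC : 1 / |b| ≤ C) :
    HasMomentBound (limitLaw c b) 1 C := by
  have hb' := abs_pos.2 hb
  have hC0 : 0 ≤ C := le_trans (by positivity) hC
  have := isProbabilityMeasure_limitLaw c hb
  refine .of_lintegral zero_le_one hC0 fun n ↦ ?_
  cases n with
  | zero => simp
  | succ n =>
    rw [lintegral_abs_pow_limitLaw c hb]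
    refine ENNReal.ofReal_le_ofReal ?_
    have h1 := tailWeight_le_one (u := |b| * √(c : ℝ)) (by positivity)
    calc _ ≤ 1 * ((n + 1).factorial * (1 / |b|) ^ (n + 1)) := by
          rw [one_div, inv_pow, ← div_eq_mul_inv]
          gcongr
      _ ≤ 1 * ((n + 1).factorial * C ^ (n + 1)) := by gcongr
      _ = _ := by ring

/-! ### Convergence in distribution of the occupation time -/

section

variable {Ω : Type*} [MeasurableSpace Ω] {P : Measure Ω} {B : ℝ≥0 → Ω → ℝ}

lemma IsStrictBrownian.measurable_occupation (hB : IsStrictBrownian B P) (b ε c y : ℝ) :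
    Measurable fun ω ↦ occupation (fun t ↦ B t ω) b ε c y :=
  (_root_.measurable_occupation hB.measurable hB.continuous b ε).comp
    (by fun_prop : Measurable fun ω : Ω ↦ (c, y, ω))

lemma greenUpper_ne_top {b c : ℝ} (hb : 0 < b) (hc : 0 ≤ c) (η : ℝ) : greenUpper b c η ≠ ∞ := by
  rw [greenUpper, greenKernel_zero hb hc]
  exact ENNReal.mul_ne_top ENNReal.ofReal_ne_top ENNReal.ofReal_ne_top

lemma IsStrictBrownian.ae_occupation_lt_top [IsProbabilityMeasure P] (hB : IsStrictBrownian B P)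
    {b ε : ℝ} (hb : 0 < b) (hε : 0 < ε) {c : ℝ} (hc : 0 ≤ c) :
    ∀ᵐ ω ∂P, occupation (fun t ↦ B t ω) b ε c 0 < ∞ := by
  refine ae_lt_top (hB.measurable_occupation b ε c 0) (ne_top_of_le_ne_top
    (greenUpper_ne_top hb hc ε) (hB.lintegral_occupation_mem hb hε hc ?_).2)
  rw [abs_zero]
  positivity

lemma IsStrictBrownian.lintegral_map_occupation [IsProbabilityMeasure P]
    (hB : IsStrictBrownian B P) {b ε : ℝ} (hb : 0 < b) (hε : 0 < ε) {c : ℝ} (hc : 0 ≤ c) (n : ℕ) :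
    ∫⁻ x, ENNReal.ofReal (|x| ^ n) ∂(P.map fun ω ↦ (occupation (fun t ↦ B t ω) b ε c 0).toReal) =
      ∫⁻ ω, occupation (fun t ↦ B t ω) b ε c 0 ^ n ∂P := by
  rw [lintegral_map (by fun_prop) (hB.measurable_occupation b ε c 0).ennreal_toReal]
  refine lintegral_congr_ae ?_
  filter_upwards [hB.ae_occupation_lt_top hb hε hc] with ω hω
  rw [abs_of_nonneg ENNReal.toReal_nonneg, ← ENNReal.toReal_pow,
    ENNReal.ofReal_toReal (ENNReal.pow_ne_top hω.ne)]

lemma tendsto_greenUpper {b c : ℝ} (hb : 0 < b) (hc : 0 ≤ c) :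
    Tendsto (greenUpper b c) (𝓝 0) (𝓝 (greenKernel b c 0)) := by
  have h1 : Continuous fun η : ℝ ↦ ENNReal.ofReal (Real.exp (b * η)) :=
    ENNReal.continuous_ofReal.comp (by fun_prop)
  have h2 := ENNReal.Tendsto.mul_const (b := greenKernel b c 0) (h1.tendsto 0)
    (Or.inr (by rw [greenKernel_zero hb hc]; exact ENNReal.ofReal_ne_top))
  simp only [mul_zero, Real.exp_zero, ENNReal.ofReal_one, one_mul] at h2
  exact h2

/-- Convergence of the moments of the normalised occupation time. -/
lemma IsStrictBrownian.tendsto_lintegral_occupation_pow [IsProbabilityMeasure P]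
    (hB : IsStrictBrownian B P) {b : ℝ} (hb : 0 < b) {c : ℝ} (hc : 0 ≤ c) (n : ℕ) :
    Tendsto (fun ε ↦ ∫⁻ ω, occupation (fun t ↦ B t ω) b ε c 0 ^ (n + 1) ∂P) (𝓝[>] 0)
      (𝓝 (ENNReal.ofReal (tailWeight (b * √c) * ((n + 1).factorial / b ^ (n + 1))))) := by
  have hfin : ∀ {c : ℝ}, 0 ≤ c → greenKernel b c 0 ≠ ∞ := fun hc ↦ by
    rw [greenKernel_zero hb hc]; exact ENNReal.ofReal_ne_top
  have hval : ((n + 1).factorial : ℝ≥0∞) * greenKernel b 0 0 ^ n * greenKernel b c 0 =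
      ENNReal.ofReal (tailWeight (b * √c) * ((n + 1).factorial / b ^ (n + 1))) := by
    rw [greenKernel_zero_zero hb, greenKernel_zero hb hc, ← ENNReal.ofReal_natCast,
      ← ENNReal.ofReal_pow (by positivity), ← ENNReal.ofReal_mul (by positivity),
      ← ENNReal.ofReal_mul (by positivity)]
    congr 1
    rw [one_div, inv_pow, pow_succ]
    field_simp
  have hlim : ∀ {f g : ℝ → ℝ≥0∞}, Tendsto f (𝓝 0) (𝓝 (greenKernel b 0 0)) →
      Tendsto g (𝓝 0) (𝓝 (greenKernel b c 0)) →
      Tendsto (fun ε ↦ ((n + 1).factorial : ℝ≥0∞) * f ε ^ n * g ε) (𝓝[>] 0)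
        (𝓝 (((n + 1).factorial : ℝ≥0∞) * greenKernel b 0 0 ^ n * greenKernel b c 0)) := by
    intro f g hf hg
    refine Tendsto.mono_left ?_ nhdsWithin_le_nhds
    have h1 := ENNReal.Tendsto.const_mul (a := ((n + 1).factorial : ℝ≥0∞))
      ((ENNReal.continuous_pow n).tendsto _ |>.comp hf) (Or.inr (ENNReal.natCast_ne_top _))
    exact ENNReal.Tendsto.mul h1 (Or.inr (hfin hc)) hg (Or.inr (ENNReal.mul_ne_top
      (ENNReal.natCast_ne_top _) (ENNReal.pow_ne_top (hfin le_rfl))))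
  rw [← hval]
  have hmem : ∀ᶠ ε : ℝ in 𝓝[>] 0, 0 < ε := self_mem_nhdsWithin
  refine tendsto_of_tendsto_of_tendsto_of_le_of_le'
    (hlim (tendsto_greenLower (hfin le_rfl) le_rfl) (tendsto_greenLower (hfin hc) hc))
    (hlim (tendsto_greenUpper hb le_rfl) (tendsto_greenUpper hb hc)) ?_ ?_
  · filter_upwards [hmem] with ε hε
    exact (IsStrictBrownian.lintegral_occupation_pow_mem hb hε n hB hc
      (by rw [abs_zero]; positivity)).1
  · filter_upwards [hmem] with ε hε
    exact (IsStrictBrownian.lintegral_occupation_pow_mem hb hε n hB hc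
      (by rw [abs_zero]; positivity)).2

/-- For `ε ≤ 1` the factor `exp(b ε)` is at most `exp b` and `k ≤ 1`, so one constant serves all
such `ε`. -/
lemma IsStrictBrownian.hasMomentBound_occupation [IsProbabilityMeasure P]
    (hB : IsStrictBrownian B P) {b ε : ℝ} (hb : 0 < b) (hε : 0 < ε) (hε1 : ε ≤ 1) {c : ℝ}
    (hc : 0 ≤ c) :
    HasMomentBound (P.map fun ω ↦ (occupation (fun t ↦ B t ω) b ε c 0).toReal) 1
      (Real.exp b / b) := by
  refine .of_lintegral zero_le_one (by positivity) fun n ↦ ?_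
  rw [hB.lintegral_map_occupation hb hε hc]
  cases n with
  | zero => simp
  | succ n =>
    have hU : ∀ {c : ℝ}, 0 ≤ c → greenUpper b c ε ≤ ENNReal.ofReal (Real.exp b / b) := by
      intro c hc
      rw [greenUpper, greenKernel_zero hb hc, ← ENNReal.ofReal_mul (by positivity),
        div_eq_mul_one_div (Real.exp b)]
      refine ENNReal.ofReal_le_ofReal ?_
      have := tailWeight_le_one (u := b * √c) (by positivity)
      have h0 := tailWeight_nonneg (b * √c)
      gcongr
      nlinarith
    refine (IsStrictBrownian.lintegral_occupation_pow_mem hb hε n hB hc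
      (by rw [abs_zero]; positivity)).2.trans ?_
    calc _ ≤ ((n + 1).factorial : ℝ≥0∞) * ENNReal.ofReal (Real.exp b / b) ^ n *
          ENNReal.ofReal (Real.exp b / b) := by
          gcongr
          · exact hU le_rfl
          · exact hU hc
      _ = _ := by
          rw [one_mul, ENNReal.ofReal_mul (by positivity), ENNReal.ofReal_pow (by positivity),
            ENNReal.ofReal_natCast, pow_succ, mul_assoc]

lemma IsStrictBrownian.tendstoInDistribution_occupation [IsProbabilityMeasure P]
    (hB : IsStrictBrownian B P) {b : ℝ} (hb : 0 < b) (c : ℝ≥0)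
    [IsProbabilityMeasure (limitLaw c b)] :
    TendstoInDistribution (fun (ε : ℝ) (ω : Ω) ↦ (occupation (fun t ↦ B t ω) b ε c 0).toReal)
      (𝓝[>] 0) (id : ℝ → ℝ) (fun _ ↦ P) (limitLaw c b) := by
  have hm : ∀ ε, Measurable fun ω ↦ (occupation (fun t ↦ B t ω) b ε c 0).toReal :=
    fun ε ↦ (hB.measurable_occupation b ε c 0).ennreal_toReal
  have hpos : ∀ᶠ ε : ℝ in 𝓝[>] 0, 0 < ε := self_mem_nhdsWithin
  refine ⟨fun ε ↦ (hm ε).aemeasurable, aemeasurable_id, ?_⟩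
  refine tendsto_probabilityMeasure_of_moments (A := 1) (C := Real.exp b / b) (by positivity)
    ?_ ?_ ?_
  · filter_upwards [hpos, nhdsWithin_le_nhds (Iic_mem_nhds zero_lt_one)] with ε hε hε1
    exact hB.hasMomentBound_occupation hb hε hε1 c.coe_nonneg
  · simp only [ProbabilityMeasure.coe_mk, Measure.map_id]
    refine hasMomentBound_limitLaw c hb.ne' ?_
    rw [abs_of_pos hb]
    gcongr
    exact Real.one_le_exp hb.le
  · intro n
    simp only [ProbabilityMeasure.coe_mk, Measure.map_id]
    cases n with
    | zero =>
      have : ∀ ε, IsProbabilityMeasure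
          (P.map fun ω ↦ (occupation (fun t ↦ B t ω) b ε c 0).toReal) :=
        fun ε ↦ Measure.isProbabilityMeasure_map (hm ε).aemeasurable
      simp
    | succ n =>
      rw [integral_pow_eq_toReal_lintegral (ae_nonneg_limitLaw c b),
        lintegral_abs_pow_limitLaw c hb.ne', abs_of_pos hb]
      have h1 := (ENNReal.tendsto_toReal ENNReal.ofReal_ne_top).comp
        (hB.tendsto_lintegral_occupation_pow hb c.coe_nonneg n)
      refine h1.congr' ?_
      filter_upwards [hpos] with ε hε
      rw [integral_pow_eq_toReal_lintegral, hB.lintegral_map_occupation hb hε c.coe_nonneg]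
      · rfl
      · exact (ae_map_iff (hm ε).aemeasurable measurableSet_Ici).2
          (ae_of_all _ fun ω ↦ ENNReal.toReal_nonneg)

end

/-! ### First crossings on a grid -/

lemma gaussianReal_Ioi_zero (v : ℝ≥0) :
    (gaussianReal 0 v) (Set.Ioi 0) = (gaussianReal 0 v) (Set.Iio 0) := by
  have e := gaussianReal_map_neg (μ := 0) (v := v)
  rw [neg_zero] at e
  conv_lhs => rw [← e]
  rw [Measure.map_apply measurable_neg measurableSet_Ioi]
  congr 1
  ext x
  simp

/-- For `v = 0` the law is an atom at `0`: symmetry gives only at most one half for the open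
half-line and at least one half for the closed one. -/
lemma two_mul_gaussianReal_Ioi_le (v : ℝ≥0) : 2 * (gaussianReal 0 v) (Set.Ioi 0) ≤ 1 := by
  have hd : Disjoint (Set.Iio (0 : ℝ)) (Set.Ioi 0) :=
    Set.disjoint_left.2 fun x (h1 : x < 0) (h2 : 0 < x) ↦ absurd h1 h2.le.not_gt
  calc 2 * (gaussianReal 0 v) (Set.Ioi 0)
      = (gaussianReal 0 v) (Set.Iio 0) + (gaussianReal 0 v) (Set.Ioi 0) := by
        rw [two_mul, gaussianReal_Ioi_zero]
    _ = (gaussianReal 0 v) (Set.Iio 0 ∪ Set.Ioi 0) := (measure_union hd measurableSet_Ioi).symm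
    _ ≤ 1 := prob_le_one

lemma one_le_two_mul_gaussianReal_Ici (v : ℝ≥0) : 1 ≤ 2 * (gaussianReal 0 v) (Set.Ici 0) := by
  calc 1 = (gaussianReal 0 v) (Set.Iio 0 ∪ Set.Ici 0) := by
        rw [Set.Iio_union_Ici, measure_univ]
    _ ≤ (gaussianReal 0 v) (Set.Iio 0) + (gaussianReal 0 v) (Set.Ici 0) := measure_union_le _ _
    _ ≤ (gaussianReal 0 v) (Set.Ici 0) + (gaussianReal 0 v) (Set.Ici 0) := by
        rw [← gaussianReal_Ioi_zero]
        gcongr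
        exact Set.Ioi_subset_Ici_self
    _ = _ := (two_mul _).symm

section

variable {Ω : Type*}

/-- The event that the sequence `B (s 0), B (s 1), …` exceeds `b` for the first time at step `k`. -/
def firstCrossing (B : ℝ≥0 → Ω → ℝ) (s : ℕ → ℝ≥0) (b : ℝ) (k : ℕ) : Set Ω :=
  {ω | b < B (s k) ω ∧ ∀ j < k, B (s j) ω ≤ b}

lemma pairwiseDisjoint_firstCrossing (B : ℝ≥0 → Ω → ℝ) (s : ℕ → ℝ≥0) (b : ℝ) (I : Set ℕ) :
    I.PairwiseDisjoint (firstCrossing B s b) := by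
  intro i _ j _ hij
  refine Set.disjoint_left.2 fun ω hi hj ↦ ?_
  rcases lt_or_gt_of_ne hij with h | h
  · exact absurd hi.1 (not_lt.2 (hj.2 i h))
  · exact absurd hj.1 (not_lt.2 (hi.2 j h))

lemma exists_mem_firstCrossing {B : ℝ≥0 → Ω → ℝ} {s : ℕ → ℝ≥0} {b : ℝ} {ω : Ω} {n k : ℕ} (hk : k ≤ n)
    (h : b < B (s k) ω) : ∃ j ≤ n, ω ∈ firstCrossing B s b j := by
  classical
  have hex : ∃ k, b < B (s k) ω := ⟨k, h⟩
  exact ⟨Nat.find hex, (Nat.find_min' hex h).trans hk, Nat.find_spec hex,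
    fun j hj ↦ not_lt.1 (Nat.find_min hex hj)⟩

variable [MeasurableSpace Ω] {P : Measure Ω} {B : ℝ≥0 → Ω → ℝ}

lemma measurableSet_firstCrossing (hB : IsStrictBrownian B P) (s : ℕ → ℝ≥0) (b : ℝ) (k : ℕ) :
    MeasurableSet (firstCrossing B s b k) := by
  have h : firstCrossing B s b k = {ω | b < B (s k) ω} ∩ ⋂ j, ⋂ (_ : j < k), {ω | B (s j) ω ≤ b} := by
    ext ω
    simp [firstCrossing]
  rw [h]
  exact (measurableSet_lt measurable_const (hB.measurable _)).inter (.iInter fun j ↦ .iInter fun _ ↦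
    measurableSet_le (hB.measurable _) measurable_const)

/-- The first crossing at step `k` is determined by the path up to `s k`, and the later increment is
independent of that past. -/
lemma IsStrictBrownian.measure_firstCrossing_inter [IsProbabilityMeasure P]
    (hB : IsStrictBrownian B P) {s : ℕ → ℝ≥0} (hs : Monotone s) (b : ℝ) {k n : ℕ} (hk : k ≤ n)
    {S : Set ℝ} (hS : MeasurableSet S) :
    P (firstCrossing B s b k ∩ {ω | B (s n) ω - B (s k) ω ∈ S}) =
      P (firstCrossing B s b k) * gaussianReal 0 (s n - s k) S := by
  have hadd : s k + (s n - s k) = s n := add_tsub_cancel_of_le (hs hk)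
  have hind := (hB.toIsPreBrownianReal.indepFun_shift (s k)).comp
    (measurable_pi_apply (s n - s k)) measurable_id
  let F : Set (Set.Iic (s k) → ℝ) := {f | b < f ⟨s k, Set.mem_Iic.2 le_rfl⟩ ∧
    ∀ j (h : j < k), f ⟨s j, Set.mem_Iic.2 (hs h.le)⟩ ≤ b}
  have hF : MeasurableSet F := by
    have h : F = {f | b < f ⟨s k, Set.mem_Iic.2 le_rfl⟩} ∩
        ⋂ j, ⋂ (h : j < k), {f | f ⟨s j, Set.mem_Iic.2 (hs h.le)⟩ ≤ b} := by
      ext f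
      simp [F]
    rw [h]
    exact (measurableSet_lt measurable_const (measurable_pi_apply _)).inter
      (.iInter fun j ↦ .iInter fun _ ↦ measurableSet_le (measurable_pi_apply _) measurable_const)
  have h := hind.symm.measure_inter_preimage_eq_mul F S hF hS
  have e1 : (id ∘ fun ω (t : Set.Iic (s k)) ↦ B t ω) ⁻¹' F = firstCrossing B s b k := rfl
  have e2 : ((fun f : ℝ≥0 → ℝ ↦ f (s n - s k)) ∘ fun ω t ↦ B (s k + t) ω - B (s k) ω) =
      fun ω ↦ B (s n) ω - B (s k) ω := by
    ext ω
    simp [hadd]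
  have hlaw := ((hB.shift (s k)).toIsPreBrownianReal.hasLaw_eval (s n - s k)).map_eq
  have e3 : P ((fun ω ↦ B (s n) ω - B (s k) ω) ⁻¹' S) = gaussianReal 0 (s n - s k) S := by
    have hm : Measurable fun ω ↦ B (s n) ω - B (s k) ω := (hB.measurable _).sub (hB.measurable _)
    rw [← hlaw, hadd, Measure.map_apply hm hS]
  have h' : P (firstCrossing B s b k ∩ (fun ω ↦ B (s n) ω - B (s k) ω) ⁻¹' S) =
      P (firstCrossing B s b k) * P ((fun ω ↦ B (s n) ω - B (s k) ω) ⁻¹' S) := by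
    rw [← e1, ← e2]
    exact h
  rw [← e3]
  exact h'

/-- Lévy's maximal inequality on a finite grid. -/
lemma IsStrictBrownian.measure_exists_grid_le [IsProbabilityMeasure P]
    (hB : IsStrictBrownian B P) {s : ℕ → ℝ≥0} (hs : Monotone s) (b : ℝ) (n : ℕ) :
    P {ω | ∃ k ≤ n, b < B (s k) ω} ≤ 2 * P {ω | b < B (s n) ω} := by
  have hA := measurableSet_firstCrossing hB s b
  have hE : MeasurableSet {ω | b < B (s n) ω} := measurableSet_lt measurable_const (hB.measurable _)
  have hsub : {ω | ∃ k ≤ n, b < B (s k) ω} ⊆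
      ⋃ k ∈ Finset.range (n + 1), firstCrossing B s b k := by
    rintro ω ⟨k, hk, h⟩
    obtain ⟨j, hj, hj'⟩ := exists_mem_firstCrossing hk h
    exact Set.mem_iUnion₂.2 ⟨j, Finset.mem_range.2 (by omega), hj'⟩
  calc P {ω | ∃ k ≤ n, b < B (s k) ω}
      ≤ P (⋃ k ∈ Finset.range (n + 1), firstCrossing B s b k) := measure_mono hsub
    _ ≤ ∑ k ∈ Finset.range (n + 1), P (firstCrossing B s b k) := measure_biUnion_finset_le _ _
    _ ≤ ∑ k ∈ Finset.range (n + 1), 2 * P (firstCrossing B s b k ∩ {ω | b < B (s n) ω}) := by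
        refine Finset.sum_le_sum fun k hk ↦ ?_
        have hk' : k ≤ n := by simpa [Nat.lt_succ_iff] using hk
        -- With conditional probability at least one half the later increment is nonnegative, which
        -- keeps the endpoint above `b`.
        calc P (firstCrossing B s b k)
            ≤ P (firstCrossing B s b k) * (2 * gaussianReal 0 (s n - s k) (Set.Ici 0)) :=
              le_mul_of_one_le_right' (one_le_two_mul_gaussianReal_Ici _)
          _ = 2 * P (firstCrossing B s b k ∩ {ω | B (s n) ω - B (s k) ω ∈ Set.Ici 0}) := by
              rw [hB.measure_firstCrossing_inter hs b hk' measurableSet_Ici]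
              ring
          _ ≤ _ := by
              gcongr 2 * P ?_
              rintro ω ⟨h1, h2⟩
              refine ⟨h1, ?_⟩
              have h3 : 0 ≤ B (s n) ω - B (s k) ω := h2
              have h4 := h1.1
              simp only [Set.mem_ofPred_eq]
              linarith
    _ = 2 * P (⋃ k ∈ Finset.range (n + 1), firstCrossing B s b k ∩ {ω | b < B (s n) ω}) := by
        rw [← Finset.mul_sum, measure_biUnion_finset]
        · exact (pairwiseDisjoint_firstCrossing B s b _).mono fun k ↦ Set.inter_subset_left
        · exact fun k _ ↦ (hA k).inter hE
    _ ≤ _ := by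
        gcongr 2 * P ?_
        exact Set.iUnion₂_subset fun k _ ↦ Set.inter_subset_right

/-- Converse of the grid maximal inequality, up to an overshoot of size `δ`. -/
lemma IsStrictBrownian.le_measure_exists_grid [IsProbabilityMeasure P]
    (hB : IsStrictBrownian B P) {s : ℕ → ℝ≥0} (hs : Monotone s) (b : ℝ) {δ : ℝ} (hδ : 0 ≤ δ)
    (n : ℕ) :
    2 * P {ω | b + δ < B (s n) ω} ≤ P {ω | ∃ k ≤ n, b < B (s k) ω} +
      2 * P (⋃ k ∈ Finset.range (n + 1), firstCrossing B s b k ∩ {ω | b + δ < B (s k) ω}) := by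
  have hA := measurableSet_firstCrossing hB s b
  have hE : ∀ k, MeasurableSet {ω | b + δ < B (s k) ω} :=
    fun k ↦ measurableSet_lt measurable_const (hB.measurable _)
  have hsub : {ω | b + δ < B (s n) ω} ⊆
      ⋃ k ∈ Finset.range (n + 1), firstCrossing B s b k ∩ {ω | b + δ < B (s n) ω} := by
    intro ω h
    have h' : b + δ < B (s n) ω := h
    obtain ⟨j, hj, hj'⟩ := exists_mem_firstCrossing (b := b) (s := s) le_rfl
      (by linarith : b < B (s n) ω)
    exact Set.mem_iUnion₂.2 ⟨j, Finset.mem_range.2 (by omega), hj', h⟩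
  calc 2 * P {ω | b + δ < B (s n) ω}
      ≤ 2 * ∑ k ∈ Finset.range (n + 1), P (firstCrossing B s b k ∩ {ω | b + δ < B (s n) ω}) := by
        gcongr
        exact (measure_mono hsub).trans (measure_biUnion_finset_le _ _)
    _ = ∑ k ∈ Finset.range (n + 1),
          2 * P (firstCrossing B s b k ∩ {ω | b + δ < B (s n) ω}) := Finset.mul_sum _ _ _
    _ ≤ ∑ k ∈ Finset.range (n + 1), (P (firstCrossing B s b k) +
          2 * P (firstCrossing B s b k ∩ {ω | b + δ < B (s k) ω})) := by
        refine Finset.sum_le_sum fun k hk ↦ ?_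
        have hk' : k ≤ n := by simpa [Nat.lt_succ_iff] using hk
        -- Without overshoot at step `k`, ending above `b + δ` forces a strictly positive increment,
        -- of probability at most one half.
        have hsub' : firstCrossing B s b k ∩ {ω | b + δ < B (s n) ω} ⊆
            (firstCrossing B s b k ∩ {ω | B (s n) ω - B (s k) ω ∈ Set.Ioi 0}) ∪
              (firstCrossing B s b k ∩ {ω | b + δ < B (s k) ω}) := by
          rintro ω ⟨h1, h2⟩
          by_cases h3 : b + δ < B (s k) ω
          · exact Or.inr ⟨h1, h3⟩
          · refine Or.inl ⟨h1, ?_⟩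
            have h4 : b + δ < B (s n) ω := h2
            simp only [Set.mem_ofPred_eq, Set.mem_Ioi]
            linarith
        calc _ ≤ 2 * (P (firstCrossing B s b k ∩ {ω | B (s n) ω - B (s k) ω ∈ Set.Ioi 0}) +
                P (firstCrossing B s b k ∩ {ω | b + δ < B (s k) ω})) := by
              gcongr
              exact (measure_mono hsub').trans (measure_union_le _ _)
          _ = P (firstCrossing B s b k) * (2 * gaussianReal 0 (s n - s k) (Set.Ioi 0)) +
                2 * P (firstCrossing B s b k ∩ {ω | b + δ < B (s k) ω}) := by
              rw [hB.measure_firstCrossing_inter hs b hk' measurableSet_Ioi]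
              ring
          _ ≤ _ := by
              gcongr
              exact mul_le_of_le_one_right' (two_mul_gaussianReal_Ioi_le _)
    _ = P (⋃ k ∈ Finset.range (n + 1), firstCrossing B s b k) +
          2 * P (⋃ k ∈ Finset.range (n + 1), firstCrossing B s b k ∩ {ω | b + δ < B (s k) ω}) := by
        rw [Finset.sum_add_distrib, ← Finset.mul_sum, measure_biUnion_finset
          (pairwiseDisjoint_firstCrossing B s b _) fun k _ ↦ hA k, measure_biUnion_finset
          ((pairwiseDisjoint_firstCrossing B s b _).mono fun k ↦ Set.inter_subset_left)
          fun k _ ↦ (hA k).inter (hE k)]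
    _ ≤ _ := by
        gcongr
        refine Set.iUnion₂_subset fun k hk ω hω ↦ ⟨k, ?_, hω.1⟩
        simpa [Nat.lt_succ_iff] using hk

/-! ### From the grid to the reflection principle -/

/-- The uniform grid of mesh `T / (N + 1)`. -/
noncomputable def uniformGrid (T : ℝ≥0) (N k : ℕ) : ℝ≥0 := T * (k / (N + 1))

lemma monotone_uniformGrid (T : ℝ≥0) (N : ℕ) : Monotone (uniformGrid T N) := by
  intro i j hij
  simp only [uniformGrid]
  gcongr

lemma uniformGrid_last (T : ℝ≥0) (N : ℕ) : uniformGrid T N (N + 1) = T := by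
  have : ((N : ℝ≥0) + 1) ≠ 0 := by positivity
  rw [uniformGrid, Nat.cast_add, Nat.cast_one, div_self this, mul_one]

lemma exists_tendsto_uniformGrid {T t : ℝ≥0} (hT : 0 < T) (ht : t ≤ T) :
    ∃ k : ℕ → ℕ, (∀ N, k N ≤ N + 1) ∧ Tendsto (fun N ↦ uniformGrid T N (k N)) atTop (𝓝 t) := by
  refine ⟨fun N ↦ ⌊(t / T : ℝ) * ((N + 1 : ℕ) : ℝ)⌋₊, fun N ↦ ?_, ?_⟩
  · refine Nat.floor_le_of_le ?_
    refine mul_le_of_le_one_left (by positivity) ?_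
    exact div_le_one_of_le₀ (by exact_mod_cast ht) T.coe_nonneg
  · have h1 := (tendsto_nat_floor_mul_div_atTop (R := ℝ) (a := (t / T : ℝ)) (by positivity)).comp
      (tendsto_natCast_atTop_atTop.comp (tendsto_add_atTop_nat 1))
    rw [← NNReal.tendsto_coe]
    have h2 := h1.const_mul (T : ℝ)
    have hT' : (T : ℝ) ≠ 0 := by exact_mod_cast hT.ne'
    rw [mul_div_cancel₀ _ hT'] at h2
    refine h2.congr fun N ↦ ?_
    simp [uniformGrid]

/-- Strict exceedance is an open condition, so grid points close to an exceeding time detect it.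
Hence the indicators converge pointwise. -/
lemma eventually_exists_uniformGrid_iff {f : ℝ≥0 → ℝ} (hf : Continuous f) {T : ℝ≥0} (hT : 0 < T)
    (b : ℝ) :
    ∀ᶠ N in atTop, (∃ k ≤ N + 1, b < f (uniformGrid T N k)) ↔ ∃ t ≤ T, b < f t := by
  by_cases hω : ∃ t ≤ T, b < f t
  · obtain ⟨t, ht, h⟩ := hω
    obtain ⟨k, hk, hlim⟩ := exists_tendsto_uniformGrid hT ht
    filter_upwards [((hf.tendsto t).comp hlim).eventually (lt_mem_nhds h)] with N hN
    exact iff_of_true ⟨k N, hk N, hN⟩ ⟨t, ht, h⟩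
  · refine .of_forall fun N ↦ iff_of_false ?_ hω
    rintro ⟨k, hk, h⟩
    exact hω ⟨_, (monotone_uniformGrid T N hk).trans (uniformGrid_last T N).le, h⟩

lemma IsStrictBrownian.measurableSet_exists_uniformGrid (hB : IsStrictBrownian B P) (T : ℝ≥0)
    (b : ℝ) (N : ℕ) : MeasurableSet {ω | ∃ k ≤ N + 1, b < B (uniformGrid T N k) ω} := by
  have : {ω | ∃ k ≤ N + 1, b < B (uniformGrid T N k) ω} =
      ⋃ k, ⋃ (_ : k ≤ N + 1), {ω | b < B (uniformGrid T N k) ω} := by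
    ext ω
    simp
  rw [this]
  exact .iUnion fun k ↦ .iUnion fun _ ↦ measurableSet_lt measurable_const (hB.measurable _)

lemma IsStrictBrownian.measurableSet_exists_gt (hB : IsStrictBrownian B P) {T : ℝ≥0} (hT : 0 < T)
    (b : ℝ) : MeasurableSet {ω | ∃ t ≤ T, b < B t ω} :=
  measurableSet_of_tendsto_indicator atTop
    (fun N ↦ hB.measurableSet_exists_uniformGrid T b N)
    fun ω ↦ eventually_exists_uniformGrid_iff (hB.continuous ω) hT b

/-- The reflection principle for the maximum of Brownian motion. -/
theorem IsStrictBrownian.measure_exists_gt [IsProbabilityMeasure P]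
    (hB : IsStrictBrownian B P) {T : ℝ≥0} (hT : 0 < T) {b : ℝ} (hb : 0 ≤ b) :
    P {ω | ∃ t ≤ T, b < B t ω} = 2 * P {ω | b < B T ω} := by
  have hgt : ∀ (t : ℝ≥0) (a : ℝ), MeasurableSet {ω | a < B t ω} :=
    fun t a ↦ measurableSet_lt measurable_const (hB.measurable _)
  have hU : Tendsto (fun N ↦ P {ω | ∃ k ≤ N + 1, b < B (uniformGrid T N k) ω}) atTop
      (𝓝 (P {ω | ∃ t ≤ T, b < B t ω})) :=
    tendsto_measure_of_tendsto_indicator_of_isFiniteMeasure _ P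
      (fun N ↦ hB.measurableSet_exists_uniformGrid T b N)
      fun ω ↦ eventually_exists_uniformGrid_iff (hB.continuous ω) hT b
  refine le_antisymm ?_ ?_
  · refine le_of_tendsto' hU fun N ↦ ?_
    have := hB.measure_exists_grid_le (monotone_uniformGrid T N) b (N + 1)
    rwa [uniformGrid_last] at this
  -- At a first crossing the previous grid value is at most `b`, so an overshoot beyond `δ` is a
  -- jump that uniform continuity on `[0, T]` excludes for fine meshes.
  · have hover : ∀ δ > 0, Tendsto (fun N ↦ P (⋃ k ∈ Finset.range (N + 1 + 1),
        firstCrossing B (uniformGrid T N) b k ∩ {ω | b + δ < B (uniformGrid T N k) ω})) atTop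
        (𝓝 0) := by
      intro δ hδ
      rw [← measure_empty (μ := P)]
      refine tendsto_measure_of_ae_tendsto_indicator_of_isFiniteMeasure _ .empty (fun N ↦ ?_) ?_
      · exact Finset.measurableSet_biUnion _ fun k _ ↦
          (measurableSet_firstCrossing hB _ b k).inter (hgt _ _)
      · filter_upwards [hB.toIsPreBrownianReal.eval_zero_ae_eq_zero] with ω h0
        have huc := (isCompact_Icc (a := (0 : ℝ≥0)) (b := T)).uniformContinuousOn_of_continuous
          (hB.continuous ω).continuousOn
        obtain ⟨η, hη, hη'⟩ := Metric.uniformContinuousOn_iff.1 huc δ hδ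
        have hmesh : Tendsto (fun N : ℕ ↦ (T : ℝ) * (1 / ((N : ℝ) + 1))) atTop (𝓝 0) := by
          simpa using tendsto_one_div_add_atTop_nhds_zero_nat.const_mul (T : ℝ)
        filter_upwards [hmesh.eventually (gt_mem_nhds hη)] with N hN
        refine iff_of_false (fun hmem ↦ ?_) (Set.notMem_empty _)
        obtain ⟨k, hk, hfc, hgt'⟩ := Set.mem_iUnion₂.1 hmem
        have hlast : ∀ j ≤ N + 1, uniformGrid T N j ∈ Set.Icc 0 T := fun j hj ↦
          ⟨zero_le, (monotone_uniformGrid T N hj).trans (uniformGrid_last T N).le⟩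
        have hk' : k ≤ N + 1 := by simpa [Nat.lt_succ_iff] using hk
        have hgt2 : b + δ < B (uniformGrid T N k) ω := hgt'
        cases k with
        -- There is no previous grid point here; `B 0 = 0 ≤ b` excludes the overshoot.
        | zero =>
          have : uniformGrid T N 0 = 0 := by simp [uniformGrid]
          rw [this, h0] at hgt2
          linarith
        | succ j =>
          have h1 := hfc.2 j (Nat.lt_succ_self j)
          have hd : dist (uniformGrid T N (j + 1)) (uniformGrid T N j) < η := by
            rw [NNReal.dist_eq]
            have : ((uniformGrid T N (j + 1) : ℝ≥0) : ℝ) - (uniformGrid T N j : ℝ≥0) =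
                (T : ℝ) * (1 / ((N : ℝ) + 1)) := by
              simp only [uniformGrid]
              push_cast
              ring
            rw [this, abs_of_nonneg (by positivity)]
            exact hN
          have h2 := hη' _ (hlast _ hk') _ (hlast j (by omega)) hd
          rw [Real.dist_eq] at h2
          linarith [le_abs_self (B (uniformGrid T N (j + 1)) ω - B (uniformGrid T N j) ω)]
    have hδle : ∀ δ > 0, 2 * P {ω | b + δ < B T ω} ≤ P {ω | ∃ t ≤ T, b < B t ω} := by
      intro δ hδ
      have hlim := hU.add (ENNReal.Tendsto.const_mul (a := 2) (hover δ hδ)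
        (Or.inr ENNReal.ofNat_ne_top))
      rw [mul_zero, add_zero] at hlim
      refine ge_of_tendsto' hlim fun N ↦ ?_
      have := hB.le_measure_exists_grid (monotone_uniformGrid T N) b hδ.le (N + 1)
      rwa [uniformGrid_last] at this
    have hlim : Tendsto (fun m : ℕ ↦ P {ω | b + 1 / ((m : ℝ) + 1) < B T ω}) atTop
        (𝓝 (P {ω | b < B T ω})) := by
      refine tendsto_measure_of_tendsto_indicator_of_isFiniteMeasure _ P (fun m ↦ hgt _ _)
        fun ω ↦ ?_
      by_cases hω : b < B T ω
      · filter_upwards [tendsto_one_div_add_atTop_nhds_zero_nat.eventually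
          (gt_mem_nhds (sub_pos.2 hω))] with m hm
        exact iff_of_true (by linarith) hω
      · refine .of_forall fun m ↦ iff_of_false (fun h ↦ hω ?_) hω
        have h' : b + 1 / ((m : ℝ) + 1) < B T ω := h
        have : (0 : ℝ) < 1 / ((m : ℝ) + 1) := by positivity
        linarith
    exact le_of_tendsto' (ENNReal.Tendsto.const_mul hlim (Or.inr ENNReal.ofNat_ne_top))
      fun m ↦ hδle _ (by positivity)

/-! ### Gaussian probabilities at time `1 / c` -/

/-- The standardised value at time `1 / c` has the standard normal distribution. -/
lemma IsStrictBrownian.hasLaw_sqrt_mul (hB : IsStrictBrownian B P) {c : ℝ≥0} (hc : 0 < c) :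
    HasLaw (fun ω ↦ √(c : ℝ) * B (1 / c) ω) (gaussianReal 0 1) P := by
  have h := gaussianReal_const_mul (hB.toIsPreBrownianReal.hasLaw_eval (1 / c)) √(c : ℝ)
  convert h using 2
  · simp
  · ext
    simp [hc.ne']

lemma IsStrictBrownian.measureReal_gt (hB : IsStrictBrownian B P) {c : ℝ≥0} (hc : 0 < c) (b : ℝ) :
    P.real {ω | b < B (1 / c) ω} = 1 - stdNormalCDF (b * √(c : ℝ)) := by
  have hs : 0 < √(c : ℝ) := Real.sqrt_pos.2 (by exact_mod_cast hc)
  have e : {ω | b < B (1 / c) ω} =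
      (fun ω ↦ √(c : ℝ) * B (1 / c) ω) ⁻¹' (Set.Iic (b * √(c : ℝ)))ᶜ := by
    ext ω
    simp only [Set.mem_ofPred_eq, Set.mem_preimage, Set.mem_compl_iff, Set.mem_Iic, not_le]
    rw [mul_comm b, mul_lt_mul_iff_right₀ hs]
  rw [e, ← map_measureReal_apply ((hB.measurable _).const_mul _) measurableSet_Iic.compl,
    (hB.hasLaw_sqrt_mul hc).map_eq, probReal_compl_eq_one_sub measurableSet_Iic, stdNormalCDF,
    cdf_eq_real]

lemma IsStrictBrownian.measureReal_abs_le (hB : IsStrictBrownian B P) {c : ℝ≥0} (hc : 0 < c)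
    {b : ℝ} (hb : 0 ≤ b) :
    P.real {ω | |B (1 / c) ω| ≤ b} = 2 * stdNormalCDF (b * √(c : ℝ)) - 1 := by
  have hs : 0 < √(c : ℝ) := Real.sqrt_pos.2 (by exact_mod_cast hc)
  have := nullSingletonClass_gaussianReal (μ := 0) (one_ne_zero : (1 : ℝ≥0) ≠ 0)
  have e : {ω | |B (1 / c) ω| ≤ b} =
      (fun ω ↦ √(c : ℝ) * B (1 / c) ω) ⁻¹' (Set.Icc (-(b * √(c : ℝ))) (b * √(c : ℝ))) := by
    ext ω
    rw [Set.mem_ofPred_eq, Set.mem_preimage, Set.mem_Icc, ← abs_le, abs_mul, abs_of_pos hs, mul_comm b, mul_le_mul_iff_right₀ hs]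
  have h1 : (gaussianReal 0 1).real (Set.Ioc (-(b * √(c : ℝ))) (b * √(c : ℝ))) =
      stdNormalCDF (b * √(c : ℝ)) - stdNormalCDF (-(b * √(c : ℝ))) := by
    have hd : Set.Ioc (-(b * √(c : ℝ))) (b * √(c : ℝ)) =
        Set.Iic (b * √(c : ℝ)) \ Set.Iic (-(b * √(c : ℝ))) := by
      ext x
      simp [and_comm]
    rw [hd, measureReal_sdiff (Set.Iic_subset_Iic.2 ?_) measurableSet_Iic,
      stdNormalCDF, stdNormalCDF, cdf_eq_real, cdf_eq_real]
    have : 0 ≤ b * √(c : ℝ) := by positivity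
    linarith
  rw [e, ← map_measureReal_apply ((hB.measurable _).const_mul _) measurableSet_Icc,
    (hB.hasLaw_sqrt_mul hc).map_eq, measureReal_congr Ioc_ae_eq_Icc.symm, h1, stdNormalCDF_neg]
  ring

end

/-! ### The main theorem -/

theorem mainTheorem5 {Ω : Type*} [MeasurableSpace Ω] (P : Measure Ω) [IsProbabilityMeasure P]
    (W : ℝ≥0 → Ω → ℝ) (hW : IsBrownianReal W P) (c : ℝ≥0) (b : ℝ) (hb : b ≠ 0) :
    -- the relative times are almost surely finite, hence real random variables
    (∀ ε : ℝ, 0 < ε → ∀ᵐ ω ∂P, relativeTime W c b ε ω < ∞) ∧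
    -- convergence in distribution to the mixture as `ε → 0+`
    (∃ _ : IsProbabilityMeasure (limitLaw c b),
      TendstoInDistribution (fun (ε : ℝ) (ω : Ω) ↦ (relativeTime W c b ε ω).toReal) (𝓝[>] 0)
        (id : ℝ → ℝ) (fun _ ↦ P) (limitLaw c b)) ∧
    -- the law of the maximum of Brownian motion over `[0, 1/c]`
    (0 < c → 0 < b →
      P.real {ω | ∃ M : ℝ, IsGreatest ((fun t : ℝ≥0 ↦ W t ω) '' Set.Icc 0 (1 / c)) M ∧ M ≤ b}
          = 2 * stdNormalCDF (b * √(c : ℝ)) - 1 ∧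
      2 * stdNormalCDF (b * √(c : ℝ)) - 1 = P.real {ω | |W (1 / c) ω| ≤ b}) := by
  have hprob := isProbabilityMeasure_limitLaw c hb
  -- For `b < 0` the strip is reflected and `-W` is used. One null set serves every `ε`.
  have hocc : ∃ B : ℝ≥0 → Ω → ℝ, IsStrictBrownian B P ∧
      ∀ᵐ ω ∂P, ∀ ε, relativeTime W c b ε ω = occupation (fun t ↦ B t ω) |b| ε c 0 := by
    rcases lt_or_gt_of_ne hb with hneg | hpos
    · obtain ⟨B, hB, hWB⟩ := exists_isStrictBrownian hW.neg
      refine ⟨B, hB, ?_⟩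
      filter_upwards [hWB] with ω hω ε
      have hω' : ∀ t, W t ω = -B t ω := fun t ↦ by
        have : -W t ω = B t ω := hω t
        linarith
      rw [← relativeTime_eq_occupation B c |b| ε ω (hB.continuous ω), relativeTime, relativeTime,
        abs_of_neg hneg]
      congr 3 with t
      have : (b * t - ε / 2 ≤ W t.toNNReal ω ∧ W t.toNNReal ω ≤ b * t + ε / 2) ↔
          (-b * t - ε / 2 ≤ B t.toNNReal ω ∧ B t.toNNReal ω ≤ -b * t + ε / 2) := by
        rw [hω']
        constructor <;> rintro ⟨h1, h2⟩ <;> constructor <;> linarith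
      simp only [Set.indicator_apply, Set.mem_ofPred_eq, this]
    · obtain ⟨B, hB, hWB⟩ := exists_isStrictBrownian hW
      refine ⟨B, hB, ?_⟩
      filter_upwards [hWB] with ω hω ε
      rw [← relativeTime_eq_occupation B c |b| ε ω (hB.continuous ω), relativeTime, relativeTime,
        abs_of_pos hpos]
      simp_rw [hω]
  refine ⟨fun ε hε ↦ ?_, ⟨hprob, ?_⟩, fun hc hbpos ↦ ?_⟩
  · obtain ⟨B, hB, hWB⟩ := hocc
    filter_upwards [hWB, hB.ae_occupation_lt_top (abs_pos.2 hb) hε c.coe_nonneg] with ω h1 h2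
    rwa [h1]
  · obtain ⟨B, hB, hWB⟩ := hocc
    have hlaw : limitLaw c |b| = limitLaw c b := by simp [limitLaw]
    have : IsProbabilityMeasure (limitLaw c |b|) := hlaw ▸ hprob
    have h := hB.tendstoInDistribution_occupation (abs_pos.2 hb) c
    simp only [hlaw] at h
    refine h.congr (fun ε ↦ ?_) ae_eq_rfl
    filter_upwards [hWB] with ω hω
    rw [hω]
  · obtain ⟨B, hB, hWB⟩ := exists_isStrictBrownian hW
    have hT : 0 < 1 / c := by positivity
    have e2 : P.real {ω | |W (1 / c) ω| ≤ b} = P.real {ω | |B (1 / c) ω| ≤ b} := by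
      refine measureReal_congr ?_
      filter_upwards [hWB] with ω hω
      refine propext ?_
      change |W (1 / c) ω| ≤ b ↔ |B (1 / c) ω| ≤ b
      rw [hω]
    refine ⟨?_, by rw [e2, hB.measureReal_abs_le hc hbpos.le]⟩
    -- Continuous paths attain their maximum on the compact interval, so the event is the complement
    -- of strict exceedance.
    have e1 : P.real {ω | ∃ M : ℝ,
        IsGreatest ((fun t : ℝ≥0 ↦ W t ω) '' Set.Icc 0 (1 / c)) M ∧ M ≤ b} =
        P.real {ω | ∃ t ≤ 1 / c, b < B t ω}ᶜ := by
      refine measureReal_congr ?_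
      filter_upwards [hWB] with ω hω
      have hfun : (fun t : ℝ≥0 ↦ W t ω) = fun t ↦ B t ω := funext hω
      refine propext ?_
      change (∃ M : ℝ, IsGreatest ((fun t : ℝ≥0 ↦ W t ω) '' Set.Icc 0 (1 / c)) M ∧ M ≤ b) ↔
        ¬ ∃ t ≤ 1 / c, b < B t ω
      rw [hfun]
      constructor
      · rintro ⟨M, hM, hMb⟩ ⟨t, ht, hbt⟩
        exact absurd (hM.2 ⟨t, ⟨zero_le, ht⟩, rfl⟩) (not_le.2 (hMb.trans_lt hbt))
      · intro h
        obtain ⟨M, hM⟩ := (isCompact_Icc.image (hB.continuous ω)).exists_isGreatest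
          ((Set.nonempty_Icc.2 (zero_le : 0 ≤ 1 / c)).image _)
        refine ⟨M, hM, ?_⟩
        obtain ⟨t, ht, rfl⟩ := hM.1
        exact not_lt.1 fun hlt ↦ h ⟨t, ht.2, hlt⟩
    rw [e1, probReal_compl_eq_one_sub (hB.measurableSet_exists_gt hT b), Measure.real, hB.measure_exists_gt hT hbpos.le,
      ENNReal.toReal_mul, ← Measure.real, hB.measureReal_gt hc]
    simp only [ENNReal.toReal_ofNat]
    ring
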